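/- Let $k$ be a field, let $W$ be a finite group, and let $P$ be a locally finite poset on which $W$ acts by order automorphisms. Let $\mathcal C^W(P)$ be the category whose objects are families $V=(V_{xy})_{x\le y\in P}$ of finite-dimensional $k$-vector spaces together with linear maps $\varphi^\sigma_{xy}:V_{xy}\to V_{\sigma(x)\sigma(y)}$ for $\sigma\in W$, $x\le y$, such that $\varphi^e_{xy}=\mathrm{id}$ and $\varphi^{\sigma'}_{\sigma(x)\sigma(y)}\circ\varphi^{\sigma}_{xy}=\varphi^{\sigma'\sigma}_{xy}$; morphisms are families of linear maps commuting with the $\varphi^\sigma_{xy}$. Put $(U\otimes V)_{xz}=\bigoplus_{x\le y\le z}U_{xy}\otimes V_{yz}$. The equivariant incidence algebra $I^W(P)$ is the Grothendieck ring of $\mathcal C^W(P)$: it is generated as an abelian group by the classes $[V]$, with relations $[V]=[V']+[V'']$ for the short exact sequences $0\to V'\to V\to V''\to 0$, and $[U][V]=[U\otimes V]$. Its unit $\delta$ is the class of the object with the trivial one-dimensional representation at each $(x,x)$ and $0$ at $(x,y)$ for $x<y$. For $x\le y$ let $W_{xy}$ be the subgroup of $W$ fixing both $x$ and $y$, let $\mathrm{VRep}(W_{xy})$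 be the Grothendieck group of its finite-dimensional representations over $k$, and let $f\mapsto f_{xy}\in\mathrm{VRep}(W_{xy})$ be the map $[V]\mapsto[V_{xy}]$ on $I^W(P)$. Let $r$ be a $W$-invariant weak rank function on $P$, that is, a collection of natural numbers $r_{xy}$, $x\le y$, with $r_{xy}>0$ for $x<y$, $r_{xy}+r_{yz}=r_{xz}$ for $x\le y\le z$, and $r_{\sigma(x)\sigma(y)}=r_{xy}$ for $\sigma\in W$. For a formal power series $f=\sum_n f_n t^n$ with $f_n\in I^W(P)$ put $f_{xy}(t)=\sum_n (f_n)_{xy}t^n$. Let $\mathscr I^W(P)$ be the set of those $f$ for which each $f_{xy}(t)$ is a polynomial of degree at most $r_{xy}$, and let $\mathscr I^W_{1/2}(P)$ be the set of those $f$ for which $f_{xx}(t)=\delta_{xx}$ for all $x$ and $f_{xy}(t)$ is a polynomial of degree $<r_{xy}/2$ for all $x<y$. (The degrees of the polynomials $f_{xy}(t)$ need not be bounded uniformly in $x\le y$; when $r$ is bounded, these are subsets of $I^W(P)\otimes\mathbb Z[t]$.) For $f\in\mathscr I^W(P)$ let $\bar f\in\mathscr I^W(P)$ be the element with $\bar f_{xy}(t)=t^{r_{xy}}f_{xy}(t^{-1})$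 for all $x\le y$. An element $\kappa\in\mathscr I^W(P)$ is a $P$-kernel if $\kappa_{xx}(t)=\delta_{xx}$ for all $x\in P$ and $\bar\kappa=\kappa^{-1}$. **Theorem.** If $\kappa\in\mathscr I^W(P)$ is a $P$-kernel, then there exists a unique pair $f,g\in\mathscr I^W_{1/2}(P)$ such that $\bar f=\kappa f$ and $\bar g=g\kappa$. -/

import Mathlib

open scoped TensorProduct DirectSum

noncomputable section

universe t u v w x

/-! ### Equivariant families of finite dimensional vector spaces -/

/-- For a group `G` acting on a set `X`: a family of finite dimensional `k`-vector spaces `V p`,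
`p ∈ X`, with an action of `G` compatible with the action on `X`. The map `act σ h` is the map
`φ^σ_p : V p → V (σ p)`; the target is given as `V q` with a proof `h : σ • p = q`.
For a one-point set `X` this is a finite dimensional representation of `G`. -/
structure EqFam (k : Type u) (G : Type w) (X : Type x) [Field k] [Group G] [MulAction G X] where
  V : X → Type t
  [acg : ∀ p, AddCommGroup (V p)]
  [mod : ∀ p, Module k (V p)]
  [fin : ∀ p, FiniteDimensional k (V p)]
  act : ∀ (σ : G) {p q : X}, σ • p = q → (V p →ₗ[k] V q)
  act_one : ∀ (p : X) (h : (1 : G) • p = p) (a : V p), act 1 h a = a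
  act_mul : ∀ (τ σ : G) {p q r : X} (h : σ • p = q) (h' : τ • q = r) (h'' : (τ * σ) • p = r)
    (a : V p), act τ h' (act σ h a) = act (τ * σ) h'' a

attribute [instance] EqFam.acg EqFam.mod EqFam.fin

namespace EqFam

variable {k : Type u} {G : Type w} {X : Type x} [Field k] [Group G] [MulAction G X]

/-- Morphisms: linear maps compatible with the decomposition and with the action. -/
structure Hom (A B : EqFam.{t} k G X) where
  map : ∀ p, A.V p →ₗ[k] B.V p
  comm : ∀ (σ : G) {p q : X} (h : σ • p = q) (a : A.V p),
    map q (A.act σ h a) = B.act σ h (map p a)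

/-- `0 → A → B → C → 0` is exact. -/
def IsShortExact {A B C : EqFam.{t} k G X} (i : Hom A B) (j : Hom B C) : Prop :=
  ∀ p, Function.Injective (i.map p) ∧ Function.Exact (i.map p) (j.map p) ∧
    Function.Surjective (j.map p)

/-- The zero object. -/
def zero : EqFam.{t} k G X where
  V _ := PUnit
  act _ _ _ _ := 0
  act_one _ _ _ := rfl
  act_mul _ _ _ _ _ _ _ _ _ := rfl

/-- The representation of a subgroup `H` fixing `p` on the member `V p` of a family. -/
def fiber (A : EqFam.{t} k G X) (p : X) (H : Subgroup G) (hH : ∀ σ ∈ H, σ • p = p) :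
    EqFam.{t} k H PUnit.{1} where
  V _ := A.V p
  act σ _ _ _ := A.act (σ : G) (hH σ σ.2)
  act_one _ _ a := A.act_one p _ a
  act_mul τ σ _ _ _ _ _ _ a := A.act_mul (τ : G) (σ : G) _ _ _ a

/-- The relations `[B] = [A] + [C]` of the Grothendieck group, one for each short exact sequence. -/
def relations (k : Type u) (G : Type w) (X : Type x) [Field k] [Group G] [MulAction G X] :
    Set (FreeAbelianGroup (EqFam.{t} k G X)) :=
  {z | ∃ (A B C : EqFam.{t} k G X) (i : Hom A B) (j : Hom B C), IsShortExact i j ∧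
    z = FreeAbelianGroup.of B - (FreeAbelianGroup.of A + FreeAbelianGroup.of C)}

end EqFam

/-- The Grothendieck group of the abelian category of `G`-equivariant families over `X`. -/
def K0 (k : Type u) (G : Type w) (X : Type x) [Field k] [Group G] [MulAction G X] :
    Type (max (t + 1) u w x) :=
  FreeAbelianGroup (EqFam.{t} k G X) ⧸ AddSubgroup.closure (EqFam.relations.{t} k G X)

namespace K0

variable {k : Type u} {G : Type w} {X : Type x} [Field k] [Group G] [MulAction G X]

instance : AddCommGroup (K0.{t} k G X) :=
  inferInstanceAs
    (AddCommGroup (FreeAbelianGroup (EqFam.{t} k G X) ⧸ AddSubgroup.closure (EqFam.relations k G X)))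

/-- The class of an object. -/
def cls (A : EqFam.{t} k G X) : K0.{t} k G X :=
  QuotientAddGroup.mk (FreeAbelianGroup.of A)

/-- The universal property of the Grothendieck group. -/
def lift {M : Type*} [AddCommGroup M] (F : EqFam.{t} k G X → M)
    (hF : ∀ (A B C : EqFam.{t} k G X) (i : EqFam.Hom A B) (j : EqFam.Hom B C), EqFam.IsShortExact i j →
      F B = F A + F C) : K0.{t} k G X →+ M :=
  QuotientAddGroup.lift _ (FreeAbelianGroup.lift F) (by
    rw [AddSubgroup.closure_le]
    rintro z ⟨A, B, C, i, j, h, rfl⟩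
    simp [hF A B C i j h])

@[simp] theorem lift_cls {M : Type*} [AddCommGroup M] (F : EqFam.{t} k G X → M) (hF)
    (A : EqFam.{t} k G X) : lift F hF (cls A) = F A := by
  exact (QuotientAddGroup.lift_mk _ _ _).trans (FreeAbelianGroup.lift_apply_of _ _)

theorem cls_exact {A B C : EqFam.{t} k G X} (i : EqFam.Hom A B) (j : EqFam.Hom B C) (h : EqFam.IsShortExact i j) :
    cls B = cls A + cls C := by
  have : (QuotientAddGroup.mk (FreeAbelianGroup.of B -
      (FreeAbelianGroup.of A + FreeAbelianGroup.of C)) : K0.{t} k G X) = 0 :=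
    (QuotientAddGroup.eq_zero_iff _).2 (AddSubgroup.subset_closure ⟨A, B, C, i, j, h, rfl⟩)
  exact sub_eq_zero.1 this

theorem induction {motive : K0.{t} k G X → Prop} (z : K0.{t} k G X) (zero : motive 0)
    (cls : ∀ A, motive (cls A)) (add : ∀ a b, motive a → motive b → motive (a + b))
    (neg : ∀ a, motive a → motive (-a)) : motive z := by
  induction z using QuotientAddGroup.induction_on with
  | H z =>
    induction z using FreeAbelianGroup.induction_on with
    | zero => exact zero
    | of A => exact cls A
    | neg A h => exact neg _ h
    | add a b ha hb => exact add _ _ ha hb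

theorem cls_zero : cls (EqFam.zero : EqFam.{t} k G X) = 0 := by
  have h := cls_exact (A := EqFam.zero) (B := EqFam.zero) (C := (EqFam.zero : EqFam.{t} k G X))
    ⟨fun _ => 0, fun _ _ _ _ _ => rfl⟩ ⟨fun _ => 0, fun _ _ _ _ _ => rfl⟩
    (fun p => ⟨fun _ _ _ => rfl, fun y => ⟨fun _ => ⟨y, rfl⟩, fun _ => rfl⟩, fun y => ⟨y, rfl⟩⟩)
  simpa using h

/-- Isomorphic objects have the same class. -/
theorem cls_eq_of_bijective {A B : EqFam.{t} k G X} (f : EqFam.Hom A B)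
    (hf : ∀ p, Function.Bijective (f.map p)) : cls A = cls B := by
  have h := cls_exact (A := A) (B := B) (C := EqFam.zero) f
    ⟨fun _ => 0, fun _ _ _ _ _ => rfl⟩
    (fun p => ⟨(hf p).1, fun y => ⟨fun _ => (hf p).2 y, fun _ => rfl⟩, fun y => ⟨0, rfl⟩⟩)
  rw [h, cls_zero, add_zero]

/-- Restriction to the member at `p`, as a virtual representation of a subgroup fixing `p`. -/
def fiber (p : X) (H : Subgroup G) (hH : ∀ σ ∈ H, σ • p = p) :
    K0.{t} k G X →+ K0.{t} k H PUnit.{1} :=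
  lift (fun A => cls (A.fiber p H hH)) (fun _ _ _ i j h =>
    cls_exact (⟨fun _ => i.map p, fun σ _ _ _ a => i.comm (σ : G) (hH σ σ.2) a⟩)
      (⟨fun _ => j.map p, fun σ _ _ _ a => j.comm (σ : G) (hH σ σ.2) a⟩) (fun _ => h p))

end K0

/-- The group of finite dimensional virtual representations of `G` over `k`. -/
abbrev VRep (k : Type u) (G : Type w) [Field k] [Group G] : Type (max (t + 1) u w) :=
  K0.{t} k G PUnit.{1}

/-! ### Intervals of a poset with symmetries -/

/-- Pairs `x ≤ y` in `P`. -/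
@[ext]
structure Intv (P : Type v) [PartialOrder P] where
  lo : P
  hi : P
  le : lo ≤ hi

/-- The group `W` acts on the poset `P` by order automorphisms. -/
class PosetAction (W : Type w) (P : Type v) [Group W] [PartialOrder P] extends MulAction W P where
  smul_mono : ∀ (σ : W) {x y : P}, x ≤ y → σ • x ≤ σ • y

section

variable {k : Type u} {W : Type w} {P : Type v} [Field k] [Group W] [PartialOrder P]
  [PosetAction W P]

instance : MulAction W (Intv P) where
  smul σ p := ⟨σ • p.lo, σ • p.hi, PosetAction.smul_mono σ p.le⟩
  one_smul p := Intv.ext (one_smul W p.lo) (one_smul W p.hi)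
  mul_smul σ τ p := Intv.ext (mul_smul σ τ p.lo) (mul_smul σ τ p.hi)

theorem Intv.smul_lo (σ : W) (p : Intv P) : (σ • p).lo = σ • p.lo := rfl

theorem Intv.smul_hi (σ : W) (p : Intv P) : (σ • p).hi = σ • p.hi := rfl

variable (W) in
/-- The group `W_{xy} = W_x ∩ W_y`. -/
abbrev Intv.stab (p : Intv P) : Subgroup W :=
  MulAction.stabilizer W p.lo ⊓ MulAction.stabilizer W p.hi

theorem Intv.stab_smul (p : Intv P) (σ : W) (h : σ ∈ p.stab W) : σ • p = p :=
  Intv.ext h.1 h.2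

/-- The interval `[x, y]` for `y ∈ [x, z]`. -/
abbrev Intv.left (p : Intv P) (y : Set.Icc p.lo p.hi) : Intv P := ⟨p.lo, y, y.2.1⟩

/-- The interval `[y, z]` for `y ∈ [x, z]`. -/
abbrev Intv.right (p : Intv P) (y : Set.Icc p.lo p.hi) : Intv P := ⟨y, p.hi, y.2.2⟩

/-- The action of `σ` as a map `[x, z] → [σ x, σ z]`. -/
abbrev Intv.move {p q : Intv P} (σ : W) (h : σ • p = q) (y : Set.Icc p.lo p.hi) :
    Set.Icc q.lo q.hi :=
  ⟨σ • (y : P), by subst h; exact ⟨PosetAction.smul_mono σ y.2.1, PosetAction.smul_mono σ y.2.2⟩⟩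

theorem Intv.move_left {p q : Intv P} (σ : W) (h : σ • p = q) (y : Set.Icc p.lo p.hi) :
    σ • p.left y = q.left (Intv.move σ h y) := by subst h; rfl

theorem Intv.move_right {p q : Intv P} (σ : W) (h : σ • p = q) (y : Set.Icc p.lo p.hi) :
    σ • p.right y = q.right (Intv.move σ h y) := by subst h; rfl

namespace EqFam

theorem act_congr (A : EqFam.{t} k W (Intv P)) {σ τ : W} (e : σ = τ) {p q : Intv P}
    (h : σ • p = q) (h' : τ • p = q) (a : A.V p) : A.act σ h a = A.act τ h' a := by
  subst e; rfl

open Classical in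
/-- The map `(U ⊗ V)_p → (U ⊗ V)_{σ p}` induced by the actions on `U` and `V`. -/
def tensorAct (A B : EqFam.{t} k W (Intv P)) (σ : W) {p q : Intv P} (h : σ • p = q) :
    (⨁ y : Set.Icc p.lo p.hi, A.V (p.left y) ⊗[k] B.V (p.right y)) →ₗ[k]
      ⨁ y : Set.Icc q.lo q.hi, A.V (q.left y) ⊗[k] B.V (q.right y) :=
  DirectSum.toModule k _ _ fun y =>
    (DirectSum.lof k _ (fun y => A.V (q.left y) ⊗[k] B.V (q.right y)) (Intv.move σ h y)).comp
      (TensorProduct.map (A.act σ (Intv.move_left σ h y)) (B.act σ (Intv.move_right σ h y)))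

open Classical in
theorem tensorAct_lof (A B : EqFam.{t} k W (Intv P)) (σ : W) {p q : Intv P} (h : σ • p = q)
    (y : Set.Icc p.lo p.hi) (a : A.V (p.left y)) (b : B.V (p.right y)) :
    tensorAct A B σ h (DirectSum.lof k _ (fun y => A.V (p.left y) ⊗[k] B.V (p.right y)) y
      (a ⊗ₜ b)) =
    DirectSum.lof k _ (fun y => A.V (q.left y) ⊗[k] B.V (q.right y)) (Intv.move σ h y)
      (A.act σ (Intv.move_left σ h y) a ⊗ₜ B.act σ (Intv.move_right σ h y) b) := by
  simp [tensorAct]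

open Classical in
/-- Equal indices: the summands are identified through the action of the identity. -/
theorem lof_congr (A B : EqFam.{t} k W (Intv P)) {q : Intv P} {y z : Set.Icc q.lo q.hi}
    (h : y = z) {p p' : Intv P} (σ τ : W) (e : σ = τ) (a : A.V p) (b : B.V p')
    (h1 : σ • p = q.left y) (h2 : τ • p = q.left z)
    (h3 : σ • p' = q.right y) (h4 : τ • p' = q.right z) :
    DirectSum.lof k _ (fun y => A.V (q.left y) ⊗[k] B.V (q.right y)) y
      (A.act σ h1 a ⊗ₜ B.act σ h3 b) =
    DirectSum.lof k _ (fun y => A.V (q.left y) ⊗[k] B.V (q.right y)) z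
      (A.act τ h2 a ⊗ₜ B.act τ h4 b) := by
  subst h; subst e; rfl

variable [LocallyFiniteOrder P]

open Classical in
/-- The tensor product `(U ⊗ V)_{xz} = ⨁_{x ≤ y ≤ z} U_{xy} ⊗ V_{yz}`. -/
def tensor (A B : EqFam.{max u v} k W (Intv P)) : EqFam.{max u v} k W (Intv P) where
  V p := ⨁ y : Set.Icc p.lo p.hi, A.V (p.left y) ⊗[k] B.V (p.right y)
  act σ _ _ h := tensorAct A B σ h
  act_one p h a := by
    suffices H : tensorAct A B 1 h = LinearMap.id from LinearMap.congr_fun H a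
    refine DirectSum.linearMap_ext _ fun y => TensorProduct.ext' fun a b => ?_
    have h1 : (1 : W) • p.left y = p.left y := one_smul _ _
    have h2 : (1 : W) • p.right y = p.right y := one_smul _ _
    simp only [LinearMap.comp_apply, tensorAct_lof, LinearMap.id_apply]
    rw [lof_congr A B (z := y) (Subtype.ext (one_smul W (y : P))) 1 1 rfl a b _ h1 _ h2,
      A.act_one, B.act_one]
  act_mul τ σ p q r h h' h'' a := by
    suffices H : (tensorAct A B τ h').comp (tensorAct A B σ h) = tensorAct A B (τ * σ) h'' from
      LinearMap.congr_fun H a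
    refine DirectSum.linearMap_ext _ fun y => TensorProduct.ext' fun a b => ?_
    simp only [LinearMap.comp_apply, tensorAct_lof]
    have e : Intv.move τ h' (Intv.move σ h y) = Intv.move (τ * σ) h'' y :=
      Subtype.ext (mul_smul τ σ (y : P)).symm
    rw [A.act_mul τ σ _ _ ((Intv.move_left _ h'' y).trans (by rw [e])),
      B.act_mul τ σ _ _ ((Intv.move_right _ h'' y).trans (by rw [e]))]
    exact lof_congr A B e _ _ rfl a b _ _ _ _

/-- The unit object: the trivial representation on the intervals `[x, x]`, and zero elsewhere. -/
def unit : EqFam.{max u v} k W (Intv P) where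
  V p := ULift.{v} (PLift (p.lo = p.hi)) → k
  act σ _ _ h := LinearMap.funLeft k k fun e =>
    ⟨⟨by subst h; exact MulAction.injective σ e.down.down⟩⟩
  act_one _ _ _ := rfl
  act_mul _ _ _ _ _ _ _ _ _ := rfl


/-- Naturality of the tensor product. -/
def tensorMap {A B C D : EqFam.{max u v} k W (Intv P)} (f : Hom A B) (g : Hom C D) :
    Hom (A.tensor C) (B.tensor D) where
  map p := DirectSum.lmap fun y => TensorProduct.map (f.map (p.left y)) (g.map (p.right y))
  comm σ p q h a := by
    classical
    suffices H : (DirectSum.lmap fun y => TensorProduct.map (f.map (q.left y))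
        (g.map (q.right y))).comp (tensorAct A C σ h) =
        (tensorAct B D σ h).comp (DirectSum.lmap fun y => TensorProduct.map (f.map (p.left y))
        (g.map (p.right y))) from LinearMap.congr_fun H a
    refine DirectSum.linearMap_ext _ fun y => TensorProduct.ext' fun a b => ?_
    simp only [LinearMap.comp_apply, tensorAct_lof, DirectSum.lmap_lof, TensorProduct.map_tmul,
      f.comm, g.comm]

theorem lmap_exact {ι : Type*} [Finite ι] {M N L : ι → Type*} [∀ i, AddCommGroup (M i)]
    [∀ i, AddCommGroup (N i)] [∀ i, AddCommGroup (L i)] [∀ i, Module k (M i)]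
    [∀ i, Module k (N i)] [∀ i, Module k (L i)] (f : ∀ i, M i →ₗ[k] N i) (g : ∀ i, N i →ₗ[k] L i)
    (h : ∀ i, Function.Exact (f i) (g i)) :
    Function.Exact (DirectSum.lmap f) (DirectSum.lmap g) := by
  classical
  have := Fintype.ofFinite ι
  intro z
  constructor
  · intro hz
    have hz' : ∀ i, g i (z i) = 0 := fun i => by rw [← DirectSum.lmap_apply, hz]; rfl
    choose m hm using fun i => (h i (z i)).1 (hz' i)
    refine ⟨(DirectSum.linearEquivFunOnFintype k ι M).symm m, ?_⟩
    ext i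
    rw [DirectSum.lmap_apply, ← hm i]
    exact congrArg _ <| congrFun ((DirectSum.linearEquivFunOnFintype k ι M).apply_symm_apply m) i
  · rintro ⟨m, rfl⟩
    ext i
    rw [DirectSum.lmap_apply, DirectSum.lmap_apply]
    exact (h i).apply_apply_eq_zero (m i)

def Hom.id (A : EqFam.{t} k W (Intv P)) : Hom A A := ⟨fun _ => LinearMap.id, fun _ _ _ _ _ => rfl⟩

theorem tensor_exact_left (U : EqFam.{max u v} k W (Intv P)) {A B C : EqFam.{max u v} k W (Intv P)}
    (i : Hom A B) (j : Hom B C) (h : IsShortExact i j) :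
    IsShortExact (tensorMap (Hom.id U) i) (tensorMap (Hom.id U) j) := fun p =>
  ⟨(DirectSum.lmap_injective _).2 fun y =>
      Module.Flat.lTensor_preserves_injective_linearMap _ (h (p.right y)).1,
    lmap_exact _ _ fun y => lTensor_exact _ (h (p.right y)).2.1 (h (p.right y)).2.2,
    (DirectSum.lmap_surjective _).2 fun y => LinearMap.lTensor_surjective _ (h (p.right y)).2.2⟩

theorem tensor_exact_right (U : EqFam.{max u v} k W (Intv P)) {A B C : EqFam.{max u v} k W (Intv P)}
    (i : Hom A B) (j : Hom B C) (h : IsShortExact i j) :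
    IsShortExact (tensorMap i (Hom.id U)) (tensorMap j (Hom.id U)) := fun p =>
  ⟨(DirectSum.lmap_injective _).2 fun y =>
      Module.Flat.rTensor_preserves_injective_linearMap _ (h (p.left y)).1,
    lmap_exact _ _ fun y => rTensor_exact _ (h (p.left y)).2.1 (h (p.left y)).2.2,
    (DirectSum.lmap_surjective _).2 fun y => LinearMap.rTensor_surjective _ (h (p.left y)).2.2⟩

/-! The associativity and unit isomorphisms. -/

open Classical in
/-- The element `a ⊗ b` of the summand of `(A ⊗ B)_{xz}` with index `y`. -/
def pure (A B : EqFam.{max u v} k W (Intv P)) (p : Intv P) (y : Set.Icc p.lo p.hi) :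
    A.V (p.left y) ⊗[k] B.V (p.right y) →ₗ[k] (A.tensor B).V p :=
  DirectSum.lof k _ (fun y => A.V (p.left y) ⊗[k] B.V (p.right y)) y

theorem pure_ext {A B : EqFam.{max u v} k W (Intv P)} {p : Intv P} {M : Type*} [AddCommGroup M]
    [Module k M] {f g : (A.tensor B).V p →ₗ[k] M}
    (h : ∀ y a b, f (pure A B p y (a ⊗ₜ b)) = g (pure A B p y (a ⊗ₜ b))) : f = g := by
  classical
  exact DirectSum.linearMap_ext _ fun y => TensorProduct.ext' fun a b => h y a b

open Classical in
/-- The map out of `(A ⊗ B)_{xz}` with given restrictions to the summands. -/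
def desc {A B : EqFam.{max u v} k W (Intv P)} {p : Intv P} {M : Type*} [AddCommGroup M]
    [Module k M] (f : ∀ y : Set.Icc p.lo p.hi, A.V (p.left y) ⊗[k] B.V (p.right y) →ₗ[k] M) :
    (A.tensor B).V p →ₗ[k] M :=
  DirectSum.toModule k _ _ f

theorem desc_pure {A B : EqFam.{max u v} k W (Intv P)} {p : Intv P} {M : Type*} [AddCommGroup M]
    [Module k M] (f : ∀ y : Set.Icc p.lo p.hi, A.V (p.left y) ⊗[k] B.V (p.right y) →ₗ[k] M)
    (y) (a) : desc f (pure A B p y a) = f y a := by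
  classical
  exact DirectSum.toModule_lof k _ _

theorem act_pure (A B : EqFam.{max u v} k W (Intv P)) (σ : W) {p q : Intv P} (h : σ • p = q)
    (y : Set.Icc p.lo p.hi) (a : A.V (p.left y)) (b : B.V (p.right y)) :
    (A.tensor B).act σ h (pure A B p y (a ⊗ₜ b)) = pure A B q (Intv.move σ h y)
      (A.act σ (Intv.move_left σ h y) a ⊗ₜ B.act σ (Intv.move_right σ h y) b) :=
  tensorAct_lof A B σ h y a b

section coherence

variable (A B C : EqFam.{max u v} k W (Intv P))

theorem pure_ext₁ {p : Intv P} {M : Type*} [AddCommGroup M] [Module k M]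
    {f g : ((A.tensor B).tensor C).V p →ₗ[k] M}
    (h : ∀ z y a b c, f (pure (A.tensor B) C p z (pure A B (p.left z) y (a ⊗ₜ b) ⊗ₜ c)) =
      g (pure (A.tensor B) C p z (pure A B (p.left z) y (a ⊗ₜ b) ⊗ₜ c))) : f = g := by
  refine pure_ext fun z d c => ?_
  have : f ∘ₗ pure (A.tensor B) C p z ∘ₗ (TensorProduct.mk k _ _).flip c =
      g ∘ₗ pure (A.tensor B) C p z ∘ₗ (TensorProduct.mk k _ _).flip c :=
    pure_ext fun y a b => h z y a b c
  exact LinearMap.congr_fun this d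

theorem pure_ext₂ {p : Intv P} {M : Type*} [AddCommGroup M] [Module k M]
    {f g : (A.tensor (B.tensor C)).V p →ₗ[k] M}
    (h : ∀ y z a b c, f (pure A (B.tensor C) p y (a ⊗ₜ pure B C (p.right y) z (b ⊗ₜ c))) =
      g (pure A (B.tensor C) p y (a ⊗ₜ pure B C (p.right y) z (b ⊗ₜ c)))) : f = g := by
  refine pure_ext fun y a d => ?_
  have : f ∘ₗ pure A (B.tensor C) p y ∘ₗ TensorProduct.mk k _ _ a =
      g ∘ₗ pure A (B.tensor C) p y ∘ₗ TensorProduct.mk k _ _ a :=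
    pure_ext fun z b c => h y z a b c
  exact LinearMap.congr_fun this d

def assocFun (p : Intv P) :
    ((A.tensor B).tensor C).V p →ₗ[k] (A.tensor (B.tensor C)).V p :=
  desc fun z => TensorProduct.lift <| desc fun y => TensorProduct.curry <|
    let y' : Set.Icc p.lo p.hi := ⟨y, y.2.1, y.2.2.trans z.2.2⟩
    let z' : Set.Icc (y : P) p.hi := ⟨z, y.2.2, z.2.2⟩
    pure A (B.tensor C) p y' ∘ₗ
      LinearMap.lTensor (A.V (p.left y')) (pure B C (p.right y') z') ∘ₗ
      (TensorProduct.assoc k (A.V (p.left y')) (B.V ((p.right y').left z'))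
        (C.V ((p.right y').right z'))).toLinearMap

def assocInv (p : Intv P) :
    (A.tensor (B.tensor C)).V p →ₗ[k] ((A.tensor B).tensor C).V p :=
  desc fun y => TensorProduct.lift <| LinearMap.flip <| desc fun z => LinearMap.flip <|
    TensorProduct.curry <|
    let z' : Set.Icc p.lo p.hi := ⟨z, y.2.1.trans z.2.1, z.2.2⟩
    let y' : Set.Icc p.lo (z : P) := ⟨y, y.2.1, z.2.1⟩
    pure (A.tensor B) C p z' ∘ₗ
      LinearMap.rTensor (C.V (p.right z')) (pure A B (p.left z') y') ∘ₗ
      (TensorProduct.assoc k (A.V ((p.left z').left y')) (B.V ((p.left z').right y'))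
        (C.V (p.right z'))).symm.toLinearMap

theorem assocFun_pure (p : Intv P) (z y a b c) :
    assocFun A B C p (pure (A.tensor B) C p z (pure A B (p.left z) y (a ⊗ₜ b) ⊗ₜ c)) =
      pure A (B.tensor C) p ⟨y, y.2.1, y.2.2.trans z.2.2⟩
        (a ⊗ₜ pure B C ⟨y, p.hi, y.2.2.trans z.2.2⟩ ⟨z, y.2.2, z.2.2⟩ (b ⊗ₜ c)) := by
  rw [assocFun, desc_pure, TensorProduct.lift.tmul, desc_pure]
  rfl

theorem assocInv_pure (p : Intv P) (y z a b c) :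
    assocInv A B C p (pure A (B.tensor C) p y (a ⊗ₜ pure B C (p.right y) z (b ⊗ₜ c))) =
      pure (A.tensor B) C p ⟨z, y.2.1.trans z.2.1, z.2.2⟩
        (pure A B ⟨p.lo, z, y.2.1.trans z.2.1⟩ ⟨y, y.2.1, z.2.1⟩ (a ⊗ₜ b) ⊗ₜ c) := by
  rw [assocInv, desc_pure, TensorProduct.lift.tmul, LinearMap.flip_apply, desc_pure]
  rfl

/-- The associativity isomorphism. -/
def assocHom : Hom ((A.tensor B).tensor C) (A.tensor (B.tensor C)) where
  map p := assocFun A B C p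
  comm σ p q h a := by
    suffices H : (assocFun A B C q).comp (((A.tensor B).tensor C).act σ h) =
        ((A.tensor (B.tensor C)).act σ h).comp (assocFun A B C p) from LinearMap.congr_fun H a
    refine pure_ext₁ A B C fun z y a b c => ?_
    let y' : Set.Icc p.lo p.hi := ⟨y, y.2.1, y.2.2.trans z.2.2⟩
    let z' : Set.Icc (y : P) p.hi := ⟨z, y.2.2, z.2.2⟩
    have e1 := act_pure A B σ (Intv.move_left σ h z) y a b
    have e2 := act_pure (A.tensor B) C σ h z (pure A B (p.left z) y (a ⊗ₜ b)) c
    have e3 := act_pure B C σ (Intv.move_right σ h y') z' b c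
    have e4 := act_pure A (B.tensor C) σ h y' a (pure B C (p.right y') z' (b ⊗ₜ c))
    rw [e1] at e2
    rw [e3] at e4
    refine (congrArg (assocFun A B C q) e2).trans ((assocFun_pure A B C q _ _ _ _ _).trans ?_)
    exact ((congrArg ((A.tensor (B.tensor C)).act σ h) (assocFun_pure A B C p z y a b c)).trans
      e4).symm

theorem assocHom_bijective (p : Intv P) : Function.Bijective ((assocHom A B C).map p) := by
  refine Function.bijective_iff_has_inverse.2 ⟨assocInv A B C p, fun a => ?_, fun a => ?_⟩
  · suffices H : (assocInv A B C p).comp (assocFun A B C p) = LinearMap.id from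
      LinearMap.congr_fun H a
    refine pure_ext₁ A B C fun z y a b c => ?_
    let y' : Set.Icc p.lo p.hi := ⟨y, y.2.1, y.2.2.trans z.2.2⟩
    let z' : Set.Icc (y : P) p.hi := ⟨z, y.2.2, z.2.2⟩
    have e := assocInv_pure A B C p y' z' a b c
    exact (congrArg (assocInv A B C p) (assocFun_pure A B C p z y a b c)).trans e
  · suffices H : (assocFun A B C p).comp (assocInv A B C p) = LinearMap.id from
      LinearMap.congr_fun H a
    refine pure_ext₂ A B C fun y z a b c => ?_
    let z' : Set.Icc p.lo p.hi := ⟨z, y.2.1.trans z.2.1, z.2.2⟩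
    let y' : Set.Icc p.lo (z : P) := ⟨y, y.2.1, z.2.1⟩
    have e := assocFun_pure A B C p z' y' a b c
    exact (congrArg (assocFun A B C p) (assocInv_pure A B C p y z a b c)).trans e

open Classical in
def lunitFun (p : Intv P) : (unit.tensor A).V p →ₗ[k] A.V p :=
  desc fun y => TensorProduct.lift <|
    if h : p.lo = y then
      (LinearMap.lsmul k (A.V p)).compl₁₂ (LinearMap.proj ⟨⟨h⟩⟩)
        (A.act (1 : W) (by rw [one_smul]; ext <;> simp [h]))
    else 0

theorem lunitFun_pure_pos (p : Intv P) (y : Set.Icc p.lo p.hi) (c a) (h : p.lo = y)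
    (h' : (1 : W) • p.right y = p) :
    lunitFun A p (pure unit A p y (c ⊗ₜ a)) = c ⟨⟨h⟩⟩ • A.act (1 : W) h' a := by
  rw [lunitFun, desc_pure, dif_pos h]
  rfl

theorem lunitFun_pure_neg (p : Intv P) (y : Set.Icc p.lo p.hi) (c a) (h : ¬ p.lo = y) :
    lunitFun A p (pure unit A p y (c ⊗ₜ a)) = 0 := by
  rw [lunitFun, desc_pure, dif_neg h]
  rfl

/-- The left unit isomorphism. -/
def lunitHom : Hom (unit.tensor A) A where
  map p := lunitFun A p
  comm σ p q h a := by
    suffices H : (lunitFun A q).comp ((unit.tensor A).act σ h) =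
        (A.act σ h).comp (lunitFun A p) from LinearMap.congr_fun H a
    refine pure_ext fun y c a => ?_
    have e := act_pure unit A σ h y c a
    refine (congrArg (lunitFun A q) e).trans ?_
    rw [LinearMap.comp_apply]
    have hlo : q.lo = σ • p.lo := by rw [← h]; rfl
    by_cases hy : p.lo = y
    · have hp : (1 : W) • p.right y = p := by rw [one_smul]; ext <;> simp [hy]
      have hq : (1 : W) • q.right (Intv.move σ h y) = q := by
        rw [one_smul]; ext <;> simp [hlo, hy]
      rw [lunitFun_pure_pos A q _ _ _ (hlo.trans (congrArg (σ • ·) hy)) hq, lunitFun_pure_pos A p y c a hy hp,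
        map_smul, A.act_mul 1 σ _ _ (by rw [mul_smul, Intv.move_right σ h, hq]),
        A.act_mul σ 1 _ _ (by rw [mul_smul, hp, h])]
      congr 1
      exact act_congr A (by simp) _ _ _
    · rw [lunitFun_pure_neg A p y c a hy, lunitFun_pure_neg A q _ _ _
        (fun e => hy (MulAction.injective σ (hlo.symm.trans e))), map_zero]

theorem lunitHom_bijective (p : Intv P) : Function.Bijective ((lunitHom A).map p) := by
  let y₀ : Set.Icc p.lo p.hi := ⟨p.lo, le_rfl, p.le⟩
  have hp : (1 : W) • p.right y₀ = p := one_smul _ _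
  let inv : A.V p →ₗ[k] (unit.tensor A).V p :=
    pure unit A p y₀ ∘ₗ TensorProduct.mk k ((unit : EqFam.{max u v} k W (Intv P)).V (p.left y₀)) (A.V (p.right y₀)) (fun _ => 1)
  refine Function.bijective_iff_has_inverse.2 ⟨inv, fun a => ?_, fun a => ?_⟩
  · suffices H : inv.comp (lunitFun A p) = LinearMap.id from LinearMap.congr_fun H a
    refine pure_ext fun y c a => ?_
    rw [LinearMap.comp_apply, LinearMap.id_apply]
    by_cases hy : p.lo = y
    · obtain rfl : y₀ = y := Subtype.ext hy
      rw [lunitFun_pure_pos A p y₀ c a hy hp, map_smul]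
      have key : ∀ (c d : (unit : EqFam.{max u v} k W (Intv P)).V (p.left y₀)) (s : k),
          c = s • d → pure unit A p y₀ (c ⊗ₜ a) = s • pure unit A p y₀ (d ⊗ₜ a) := by
        rintro c d s rfl
        rw [← TensorProduct.smul_tmul', map_smul]
      have ha : A.act (1 : W) hp a = a := A.act_one _ _ a
      rw [ha]
      exact (key c (fun _ => 1) (c ⟨⟨hy⟩⟩) (funext fun z => (mul_one _).symm)).symm
    · rw [lunitFun_pure_neg A p y c a hy, map_zero]
      have hc : c = 0 := by funext z; exact absurd z.down.down hy
      rw [hc, TensorProduct.zero_tmul, map_zero]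
  · refine (lunitFun_pure_pos A p y₀ (fun _ => 1) a rfl hp).trans ?_
    rw [one_smul]
    exact A.act_one _ _ a

open Classical in
def runitFun (p : Intv P) : (A.tensor unit).V p →ₗ[k] A.V p :=
  desc fun y => TensorProduct.lift <|
    if h : (y : P) = p.hi then
      (LinearMap.lsmul k (A.V p)).flip.compl₁₂
        (A.act (1 : W) (by rw [one_smul]; ext <;> simp [h])) (LinearMap.proj ⟨⟨h⟩⟩)
    else 0

theorem runitFun_pure_pos (p : Intv P) (y : Set.Icc p.lo p.hi) (a c) (h : (y : P) = p.hi)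
    (h' : (1 : W) • p.left y = p) :
    runitFun A p (pure A unit p y (a ⊗ₜ c)) = c ⟨⟨h⟩⟩ • A.act (1 : W) h' a := by
  rw [runitFun, desc_pure, dif_pos h]
  rfl

theorem runitFun_pure_neg (p : Intv P) (y : Set.Icc p.lo p.hi) (a c) (h : ¬ (y : P) = p.hi) :
    runitFun A p (pure A unit p y (a ⊗ₜ c)) = 0 := by
  rw [runitFun, desc_pure, dif_neg h]
  rfl

/-- The right unit isomorphism. -/
def runitHom : Hom (A.tensor unit) A where
  map p := runitFun A p
  comm σ p q h a := by
    suffices H : (runitFun A q).comp ((A.tensor unit).act σ h) =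
        (A.act σ h).comp (runitFun A p) from LinearMap.congr_fun H a
    refine pure_ext fun y a c => ?_
    have e := act_pure A unit σ h y a c
    refine (congrArg (runitFun A q) e).trans ?_
    rw [LinearMap.comp_apply]
    have hhi : q.hi = σ • p.hi := by rw [← h]; rfl
    by_cases hy : (y : P) = p.hi
    · have hp : (1 : W) • p.left y = p := by rw [one_smul]; ext <;> simp [hy]
      have hq : (1 : W) • q.left (Intv.move σ h y) = q := by
        rw [one_smul]; ext <;> simp [hhi, hy]
      rw [runitFun_pure_pos A q _ _ _ ((congrArg (σ • ·) hy).trans hhi.symm) hq, runitFun_pure_pos A p y a c hy hp,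
        map_smul, A.act_mul 1 σ _ _ (by rw [mul_smul, Intv.move_left σ h, hq]),
        A.act_mul σ 1 _ _ (by rw [mul_smul, hp, h])]
      congr 1
      exact act_congr A (by simp) _ _ _
    · rw [runitFun_pure_neg A p y a c hy, runitFun_pure_neg A q _ _ _
        (fun e => hy (MulAction.injective σ (e.trans hhi))), map_zero]

theorem runitHom_bijective (p : Intv P) : Function.Bijective ((runitHom A).map p) := by
  let y₀ : Set.Icc p.lo p.hi := ⟨p.hi, p.le, le_rfl⟩
  have hp : (1 : W) • p.left y₀ = p := one_smul _ _
  let inv : A.V p →ₗ[k] (A.tensor unit).V p :=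
    pure A unit p y₀ ∘ₗ
      (TensorProduct.mk k (A.V (p.left y₀)) ((unit : EqFam.{max u v} k W (Intv P)).V (p.right y₀))).flip (fun _ => 1)
  refine Function.bijective_iff_has_inverse.2 ⟨inv, fun a => ?_, fun a => ?_⟩
  · suffices H : inv.comp (runitFun A p) = LinearMap.id from LinearMap.congr_fun H a
    refine pure_ext fun y a c => ?_
    rw [LinearMap.comp_apply, LinearMap.id_apply]
    by_cases hy : (y : P) = p.hi
    · obtain rfl : y₀ = y := Subtype.ext hy.symm
      rw [runitFun_pure_pos A p y₀ a c hy hp, map_smul]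
      have key : ∀ (c d : (unit : EqFam.{max u v} k W (Intv P)).V (p.right y₀)) (s : k),
          c = s • d → pure A unit p y₀ (a ⊗ₜ c) = s • pure A unit p y₀ (a ⊗ₜ d) := by
        rintro c d s rfl
        rw [TensorProduct.tmul_smul, map_smul]
      have ha : A.act (1 : W) hp a = a := A.act_one _ _ a
      rw [ha]
      exact (key c (fun _ => 1) (c ⟨⟨hy⟩⟩) (funext fun z => (mul_one _).symm)).symm
    · rw [runitFun_pure_neg A p y a c hy, map_zero]
      have hc : c = 0 := by funext z; exact absurd z.down.down hy
      rw [hc, TensorProduct.tmul_zero, map_zero]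
  · refine (runitFun_pure_pos A p y₀ a (fun _ => 1) rfl hp).trans ?_
    rw [one_smul]
    exact A.act_one _ _ a

end coherence

end EqFam

/-! ### The equivariant incidence algebra -/

variable (k W P) in
/-- The equivariant incidence algebra `I^W(P)`: the Grothendieck ring of the category of
equivariant families over the intervals of `P`. -/
abbrev IncAlg : Type (max (u + 1) (v + 1) w) :=
  K0.{max u v} k W (Intv P)

namespace IncAlg

open K0

variable [LocallyFiniteOrder P]

/-- Multiplication: `[U] [V] = [U ⊗ V]`. -/
def mulHom : IncAlg k W P →+ IncAlg k W P →+ IncAlg k W P :=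
  K0.lift (fun U => K0.lift (fun V => cls (U.tensor V))
      (fun _ _ _ i j h => cls_exact _ _ (EqFam.tensor_exact_left U i j h)))
    (fun A B C i j h => by
      ext z
      induction z using K0.induction with
      | zero => simp
      | cls V => simpa using cls_exact _ _ (EqFam.tensor_exact_right V i j h)
      | add a b ha hb => rw [map_add, ha, hb, map_add]
      | neg a ha => rw [map_neg, ha, map_neg])

theorem mulHom_cls (U V : EqFam.{max u v} k W (Intv P)) :
    mulHom (cls U) (cls V) = cls (U.tensor V) := by
  simp [mulHom]

theorem mulHom_assoc (a b c : IncAlg k W P) :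
    mulHom (mulHom a b) c = mulHom a (mulHom b c) := by
  induction a using K0.induction with
  | zero => simp
  | add a a' h h' => simp [h, h']
  | neg a h => simp [h]
  | cls A =>
  induction b using K0.induction with
  | zero => simp
  | add a a' h h' => simp [h, h']
  | neg a h => simp [h]
  | cls B =>
  induction c using K0.induction with
  | zero => simp
  | add a a' h h' => simp [h, h']
  | neg a h => simp [h]
  | cls C =>
  simp only [mulHom_cls]
  exact cls_eq_of_bijective (EqFam.assocHom A B C) (EqFam.assocHom_bijective A B C)

instance : Ring (IncAlg k W P) where
  __ := (inferInstance : AddCommGroup (IncAlg k W P))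
  mul a b := mulHom a b
  one := cls EqFam.unit
  left_distrib a b c := map_add (mulHom a) b c
  right_distrib a b c := by
    change mulHom (a + b) c = mulHom a c + mulHom b c
    rw [map_add, AddMonoidHom.add_apply]
  zero_mul a := by
    change mulHom 0 a = 0
    rw [map_zero, AddMonoidHom.zero_apply]
  mul_zero a := map_zero (mulHom a)
  mul_assoc := mulHom_assoc
  one_mul a := by
    change mulHom (cls EqFam.unit) a = a
    induction a using K0.induction with
    | zero => simp
    | add a a' h h' => simp [h, h']
    | neg a h => simp [h]
    | cls A =>
      rw [mulHom_cls]
      exact cls_eq_of_bijective (EqFam.lunitHom A) (EqFam.lunitHom_bijective A)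
  mul_one a := by
    change mulHom a (cls EqFam.unit) = a
    induction a using K0.induction with
    | zero => simp
    | add a a' h h' => simp [h, h']
    | neg a h => simp [h]
    | cls A =>
      rw [mulHom_cls]
      exact cls_eq_of_bijective (EqFam.runitHom A) (EqFam.runitHom_bijective A)

/-- The component `f_{xy} ∈ VRep(W_{xy})` of `f ∈ I^W(P)`, for an interval `p = [x, y]`. -/
def comp (p : Intv P) : IncAlg k W P →+ VRep.{max u v} k (p.stab W) :=
  K0.fiber p (p.stab W) (Intv.stab_smul p)

end IncAlg

variable [LocallyFiniteOrder P]

/-! ### Kazhdan-Lusztig-Stanley theory -/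

variable (W P) in
/-- A `W`-invariant weak rank function on `P`. -/
structure WeakRank where
  r : Intv P → ℕ
  pos : ∀ p : Intv P, p.lo < p.hi → 0 < r p
  add : ∀ {x y z : P} (hxy : x ≤ y) (hyz : y ≤ z),
    r ⟨x, y, hxy⟩ + r ⟨y, z, hyz⟩ = r ⟨x, z, hxy.trans hyz⟩
  inv : ∀ (σ : W) (p : Intv P), r (σ • p) = r p

/-- The coefficient of `t ^ n` in the component `f_{xy}(t)`, for an interval `p = [x, y]`.
Elements are written `f = ∑ f_n t ^ n` with `f_n ∈ I^W(P)`, inside `I^W(P)⟦t⟧`, because for an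
infinite poset the degrees of the polynomials `f_{xy}(t)` need not be bounded uniformly in `x ≤ y`;
in the sets `scriptI` and `scriptIHalf` below every component `f_{xy}(t)` is a polynomial. -/
def coeffAt (f : PowerSeries (IncAlg k W P)) (p : Intv P) (n : ℕ) : VRep.{max u v} k (p.stab W) :=
  IncAlg.comp p (PowerSeries.coeff n f)

/-- `f_{xx}(t) = δ_{xx}(t)` for all `x`; here `δ = 1`. -/
def DiagOne (f : PowerSeries (IncAlg k W P)) : Prop :=
  ∀ (x : P) (n : ℕ), coeffAt f ⟨x, x, le_rfl⟩ n = coeffAt 1 ⟨x, x, le_rfl⟩ n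

/-- `𝓘^W(P)`: the elements with `deg f_{xy}(t) ≤ r_{xy}` for all `x ≤ y`. -/
def scriptI (r : WeakRank W P) : Set (PowerSeries (IncAlg k W P)) :=
  {f | ∀ (p : Intv P) (n : ℕ), r.r p < n → coeffAt f p n = 0}

/-- `𝓘^W_{1/2}(P)`: the elements with `f_{xx}(t) = δ_{xx}(t)` for all `x` and
`deg f_{xy}(t) < r_{xy} / 2` for all `x < y`. -/
def scriptIHalf (r : WeakRank W P) : Set (PowerSeries (IncAlg k W P)) :=
  {f | DiagOne f ∧
    ∀ (p : Intv P) (n : ℕ), p.lo < p.hi → r.r p ≤ 2 * n → coeffAt f p n = 0}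

/-- `g` is the element `\bar f`, that is, `g_{xy}(t) = t ^ {r_{xy}} f_{xy}(t⁻¹)` for all
`x ≤ y` (for `f ∈ 𝓘^W(P)`). -/
def IsBar (r : WeakRank W P) (f g : PowerSeries (IncAlg k W P)) : Prop :=
  ∀ (p : Intv P) (n : ℕ), coeffAt g p n = if n ≤ r.r p then coeffAt f p (r.r p - n) else 0

/-- `κ ∈ 𝓘^W(P)` is a `P`-kernel: `κ_{xx}(t) = δ_{xx}(t)` for all `x`, and `\bar κ` is the
two-sided inverse of `κ`. -/
def IsPKernel (r : WeakRank W P) (κ : PowerSeries (IncAlg k W P)) : Prop :=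
  κ ∈ scriptI r ∧ DiagOne κ ∧ ∃ κ' : PowerSeries (IncAlg k W P), IsBar r κ κ' ∧ κ * κ' = 1 ∧ κ' * κ = 1

end

end

/-!
On `𝓘^W(P)` the bar operation is a multiplicative involution. Hence, for a kernel `κ`, the additive
map `T f = \overline{κ f}` satisfies `T (T f) = \bar κ κ f = f`, and `\bar f = κ f` means `T f = f`.
As `κ_{xx} = 1`, the map `T` preserves the filtration by the rank of intervals and agrees with the
bar operation on its graded pieces. So the argument of Kazhdan and Lusztig applies: starting from
`1`, one rank at a time, the error `q = T f - f` satisfies `T q = -q`, so that `q_{xy}` is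
antisymmetric under `n ↦ r_{xy} - n` to leading order, and `q = h - T h` to this order for a unique
`h` of degree `< r_{xy} / 2`. The middle coefficient of `q_{xy}` equals its own negative and
vanishes because `VRep(W_{xy})` is torsion-free. The case `\bar g = g κ` is the same with
`T g = \overline{g κ}`.

This uses that an element of the Grothendieck ring `I^W(P)` is determined by its components, and
that elements can be glued along the rank. The former is not immediate from the definition by
generators and relations: it follows from Heller's description of equality in a Grothendieck group
through actual short exact sequences, which can be spread out along the orbits of `W`.
-/

noncomputable section

universe t u v w x

/-- The argument of Kazhdan and Lusztig for bar involutions: `split` corrects `e` one step of the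
filtration at a time, and `rigid` makes the corrections convergent and unique. -/
theorem existsUnique_fixedPoint_of_filtration {N : Type*} [AddCommGroup N]
    {F : ℕ → AddSubgroup N} {H : AddSubgroup N} {T : N →+ N} {e : N}
    (top : F 0 = ⊤) (anti : Antitone F) (separated : ∀ f, (∀ m, f ∈ F m) → f = 0)
    (complete : ∀ s : ℕ → N, (∀ m, s m ∈ H) → (∀ m, s (m + 1) - s m ∈ F m) →
      ∃ f ∈ H, ∀ m, f - s m ∈ F m)
    (map_mem : ∀ m, ∀ f ∈ F m, T f ∈ F m)
    (involutive : ∀ f, f - e ∈ H → T (T f) = f)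
    (split : ∀ m, ∀ q ∈ F m, T q = -q → ∃ h ∈ H, q + (T h - h) ∈ F (m + 1))
    (rigid : ∀ m, ∀ h ∈ H, h ∈ F m → T h - h ∈ F (m + 1) → h ∈ F (m + 1)) :
    ∃! f, f - e ∈ H ∧ T f = f := by
  have rigid' : ∀ m, ∀ h ∈ H, T h - h ∈ F m → h ∈ F m := by
    intro m
    induction m with
    | zero => simp [top]
    | succ m ih => exact fun h hH hT => rigid m h hH (ih h hH (anti m.le_succ hT)) hT
  have approx : ∀ m, ∃ h ∈ H, T (e + h) - (e + h) ∈ F m := by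
    intro m
    induction m with
    | zero => exact ⟨0, H.zero_mem, by simp [top]⟩
    | succ m ih =>
      obtain ⟨h, hH, hT⟩ := ih
      obtain ⟨h', hH', hT'⟩ := split m _ hT (by
        rw [map_sub, involutive _ (by rwa [add_sub_cancel_left]), neg_sub])
      refine ⟨h + h', H.add_mem hH hH', ?_⟩
      convert hT' using 1
      simp only [map_add]
      abel
  choose s hs hTs using approx
  obtain ⟨h, hH, hlim⟩ := complete s hs fun m => rigid' m _ (H.sub_mem (hs _) (hs _)) (by
    convert (F m).sub_mem (anti m.le_succ (hTs (m + 1))) (hTs m) using 1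
    simp only [map_add, map_sub]
    abel)
  have hT : T (e + h) = e + h := sub_eq_zero.1 (separated _ fun m => by
    convert (F m).add_mem (hTs m) ((F m).sub_mem (map_mem m _ (hlim m)) (hlim m)) using 1
    simp only [map_add, map_sub]
    abel)
  refine ⟨e + h, ⟨by rwa [add_sub_cancel_left], hT⟩, fun f ⟨hf, hTf⟩ =>
    sub_eq_zero.1 (separated _ fun m => rigid' m _ ?_ ?_)⟩
  · rw [← sub_sub]
    exact H.sub_mem hf hH
  · rw [map_sub, hTf, hT, sub_self]
    exact (F m).zero_mem

section GrothendieckGroup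

variable {k : Type u} {G : Type w} {X : Type x} [Field k] [Group G] [MulAction G X]

namespace EqFam

/-- Isomorphism of equivariant families. -/
def Isomorphic (A B : EqFam.{t} k G X) : Prop :=
  ∃ e : ∀ p, A.V p ≃ₗ[k] B.V p, ∀ (σ : G) {p q : X} (h : σ • p = q) (a : A.V p),
    e q (A.act σ h a) = B.act σ h (e p a)

theorem Isomorphic.cls_eq {A B : EqFam.{t} k G X} : Isomorphic A B → K0.cls A = K0.cls B :=
  fun ⟨e, he⟩ => K0.cls_eq_of_bijective ⟨fun p => (e p).toLinearMap, he⟩ fun p => (e p).bijective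

/-- The direct sum of two equivariant families. -/
def prod (A B : EqFam.{t} k G X) : EqFam.{t} k G X where
  V p := A.V p × B.V p
  act σ _ _ h := (A.act σ h).prodMap (B.act σ h)
  act_one p h a := Prod.ext (A.act_one p h a.1) (B.act_one p h a.2)
  act_mul τ σ _ _ _ h h' h'' a := Prod.ext (A.act_mul τ σ h h' h'' a.1) (B.act_mul τ σ h h' h'' a.2)

theorem isomorphic_prod_comm (A B : EqFam.{t} k G X) : Isomorphic (A.prod B) (B.prod A) :=
  ⟨fun _ => LinearEquiv.prodComm k _ _, fun _ _ _ _ _ => rfl⟩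

theorem isomorphic_prod_assoc (A B C : EqFam.{t} k G X) :
    Isomorphic ((A.prod B).prod C) (A.prod (B.prod C)) :=
  ⟨fun _ => LinearEquiv.prodAssoc k _ _ _, fun _ _ _ _ _ => rfl⟩

theorem isomorphic_prod_prod_comm (A B C D : EqFam.{t} k G X) :
    Isomorphic ((A.prod B).prod (C.prod D)) ((A.prod C).prod (B.prod D)) :=
  ⟨fun _ => LinearEquiv.prodProdProdComm k _ _ _ _, fun _ _ _ _ _ => rfl⟩

theorem isomorphic_prod_zero (A : EqFam.{t} k G X) : Isomorphic (A.prod zero) A :=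
  ⟨fun p => (LinearEquiv.prodUnique : (A.V p × PUnit.{t + 1}) ≃ₗ[k] A.V p), fun _ _ _ _ _ => rfl⟩

theorem Isomorphic.symm {A B : EqFam.{t} k G X} : Isomorphic A B → Isomorphic B A := by
  rintro ⟨e, he⟩
  refine ⟨fun p => (e p).symm, fun σ p q h b => ?_⟩
  rw [LinearEquiv.symm_apply_eq, he, LinearEquiv.apply_symm_apply]

theorem Isomorphic.trans {A B C : EqFam.{t} k G X} :
    Isomorphic A B → Isomorphic B C → Isomorphic A C := by
  rintro ⟨e, he⟩ ⟨f, hf⟩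
  exact ⟨fun p => (e p).trans (f p), fun σ p q h a => by simp [he, hf]⟩

theorem Isomorphic.prod_right {A B : EqFam.{t} k G X} (h : Isomorphic A B) (C : EqFam.{t} k G X) :
    Isomorphic (A.prod C) (B.prod C) :=
  ⟨fun p => (h.choose p).prodCongr (.refl k _),
    fun σ _ _ e a => Prod.ext (h.choose_spec σ e a.1) rfl⟩

/-- `E` is an extension of `C` by `A`. -/
def IsExt (A E C : EqFam.{t} k G X) : Prop :=
  ∃ (i : Hom A E) (j : Hom E C), IsShortExact i j

theorem IsExt.cls_eq {A E C : EqFam.{t} k G X} :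
    IsExt A E C → K0.cls E = K0.cls A + K0.cls C :=
  fun ⟨i, j, h⟩ => K0.cls_exact i j h

theorem isExt_prod (A C : EqFam.{t} k G X) : IsExt A (A.prod C) C :=
  ⟨⟨fun _ => LinearMap.inl k _ _, fun σ _ _ h _ => Prod.ext rfl (map_zero (C.act σ h)).symm⟩,
    ⟨fun _ => LinearMap.snd k _ _, fun _ _ _ _ _ => rfl⟩,
    fun _ => ⟨LinearMap.inl_injective, .inl_snd, LinearMap.snd_surjective⟩⟩

theorem IsExt.prod {A E C A' E' C' : EqFam.{t} k G X} :
    IsExt A E C → IsExt A' E' C' → IsExt (A.prod A') (E.prod E') (C.prod C') := by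
  rintro ⟨i, j, h⟩ ⟨i', j', h'⟩
  refine ⟨⟨fun p => (i.map p).prodMap (i'.map p), fun σ p q e a =>
      Prod.ext (i.comm σ e a.1) (i'.comm σ e a.2)⟩,
    ⟨fun p => (j.map p).prodMap (j'.map p), fun σ p q e a =>
      Prod.ext (j.comm σ e a.1) (j'.comm σ e a.2)⟩,
    fun p => ⟨(h p).1.prodMap (h' p).1, fun z => ?_, (h p).2.2.prodMap (h' p).2.2⟩⟩
  refine Prod.ext_iff.trans (((h p).2.1 z.1).and ((h' p).2.1 z.2) |>.trans ?_)
  exact ⟨fun ⟨⟨a, ha⟩, b, hb⟩ => ⟨(a, b), Prod.ext ha hb⟩,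
    fun ⟨a, ha⟩ => ⟨⟨a.1, congrArg Prod.fst ha⟩, a.2, congrArg Prod.snd ha⟩⟩

theorem IsExt.of_isomorphic {A E E' C : EqFam.{t} k G X} :
    IsExt A E C → Isomorphic E E' → IsExt A E' C := by
  rintro ⟨i, j, h⟩ ⟨e, he⟩
  refine ⟨⟨fun p => (e p).toLinearMap ∘ₗ i.map p, fun σ p q h a => by simp [i.comm, he]⟩,
    ⟨fun p => j.map p ∘ₗ (e p).symm.toLinearMap, fun σ p q h a => ?_⟩,
    fun p => ⟨(e p).injective.comp (h p).1, fun z => ?_, (h p).2.2.comp (e p).symm.surjective⟩⟩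
  · obtain ⟨y, rfl⟩ := (e p).surjective a
    simp [← he, j.comm]
  · obtain ⟨y, rfl⟩ := (e p).surjective z
    simp [(h p).2.1 y]

theorem cls_prod (A B : EqFam.{t} k G X) : K0.cls (A.prod B) = K0.cls A + K0.cls B :=
  (isExt_prod A B).cls_eq

/-- Heller's relation: after adding a common summand, `A` and `B` are extensions of the same
objects. It characterizes equality of classes in the Grothendieck group. -/
def HellerRel (A B : EqFam.{t} k G X) : Prop :=
  ∃ X Y Z, IsExt X (A.prod Z) Y ∧ IsExt X (B.prod Z) Y

namespace HellerRel

variable {A B C A' B' : EqFam.{t} k G X}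

theorem of_isExt (h : IsExt A B C) : HellerRel B (A.prod C) :=
  ⟨A, C, zero, h.of_isomorphic (isomorphic_prod_zero B).symm,
    (isExt_prod A C).of_isomorphic (isomorphic_prod_zero _).symm⟩

theorem of_isomorphic (h : Isomorphic A B) : HellerRel A B :=
  ⟨A, zero, zero, isExt_prod A zero,
    (isExt_prod A zero).of_isomorphic ((isomorphic_prod_zero A).trans
      (h.trans (isomorphic_prod_zero B).symm))⟩

theorem symm : HellerRel A B → HellerRel B A :=
  fun ⟨X, Y, Z, h, h'⟩ => ⟨X, Y, Z, h', h⟩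

theorem prod : HellerRel A B → HellerRel A' B' → HellerRel (A.prod A') (B.prod B') :=
  fun ⟨X, Y, Z, hA, hB⟩ ⟨X', Y', Z', hA', hB'⟩ => ⟨X.prod X', Y.prod Y', Z.prod Z',
    (hA.prod hA').of_isomorphic (isomorphic_prod_prod_comm _ _ _ _),
    (hB.prod hB').of_isomorphic (isomorphic_prod_prod_comm _ _ _ _)⟩

theorem of_prod : HellerRel (A.prod C) (B.prod C) → HellerRel A B :=
  fun ⟨X, Y, Z, hA, hB⟩ => ⟨X, Y, C.prod Z, hA.of_isomorphic (isomorphic_prod_assoc _ _ _),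
    hB.of_isomorphic (isomorphic_prod_assoc _ _ _)⟩

theorem trans : HellerRel A B → HellerRel B C → HellerRel A C :=
  fun ⟨X, Y, Z, hA, hB⟩ ⟨X', Y', Z', hB', hC⟩ => ⟨X.prod X', Y.prod Y', B.prod (Z.prod Z'),
    (hA.prod hB').of_isomorphic
      ((isomorphic_prod_prod_comm A Z B Z').trans (isomorphic_prod_assoc _ _ _)),
    (hB.prod hC).of_isomorphic ((isomorphic_prod_prod_comm B Z C Z').trans
      (((isomorphic_prod_comm B C).prod_right _).trans (isomorphic_prod_assoc _ _ _)))⟩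

end HellerRel

variable (k G X) in
/-- Heller's relation as a setoid. Its quotient is a cancellative monoid. -/
def hellerSetoid : Setoid (EqFam.{t} k G X) where
  r := HellerRel
  iseqv := ⟨fun _ => .of_isomorphic ⟨fun _ => .refl k _, fun _ _ _ _ _ => rfl⟩, .symm, .trans⟩

variable (k G X) in
/-- The monoid of equivariant families up to Heller's relation, under direct sum. -/
def HellerMonoid : Type _ := Quotient (hellerSetoid.{t} k G X)

instance : Add (HellerMonoid.{t} k G X) :=
  ⟨Quotient.map₂ prod fun _ _ h _ _ h' => h.prod h'⟩

instance : Zero (HellerMonoid.{t} k G X) := ⟨Quotient.mk _ zero⟩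

instance : AddCommMonoid (HellerMonoid.{t} k G X) where
  add_assoc := by
    rintro ⟨A⟩ ⟨B⟩ ⟨C⟩
    exact Quotient.sound (.of_isomorphic (isomorphic_prod_assoc A B C))
  add_comm := by
    rintro ⟨A⟩ ⟨B⟩
    exact Quotient.sound (.of_isomorphic (isomorphic_prod_comm A B))
  zero_add := by
    rintro ⟨A⟩
    exact Quotient.sound
      (.of_isomorphic ((isomorphic_prod_comm zero A).trans (isomorphic_prod_zero A)))
  add_zero := by
    rintro ⟨A⟩
    exact Quotient.sound (.of_isomorphic (isomorphic_prod_zero A))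
  nsmul := nsmulRec

instance : IsCancelAdd (HellerMonoid.{t} k G X) :=
  have : IsRightCancelAdd (HellerMonoid.{t} k G X) := ⟨by
    rintro ⟨C⟩ ⟨A⟩ ⟨B⟩ h
    exact Quotient.sound (Quotient.exact h : HellerRel (A.prod C) (B.prod C)).of_prod⟩
  AddCommMagma.IsRightCancelAdd.toIsCancelAdd _

/-- The monoid of families up to Heller's relation is cancellative, so it embeds into its group
completion. -/
theorem hellerRel_of_cls_eq {A B : EqFam.{t} k G X} (h : K0.cls A = K0.cls B) : HellerRel A B := by
  let mk (A : EqFam.{t} k G X) : HellerMonoid.{t} k G X := Quotient.mk _ A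
  let φ : K0.{t} k G X →+ Algebra.GrothendieckAddGroup (HellerMonoid.{t} k G X) :=
    K0.lift (fun A => Algebra.GrothendieckAddGroup.of (mk A)) fun A B C i j h => by
      rw [← map_add]
      exact congrArg Algebra.GrothendieckAddGroup.of
        (show mk B = mk A + mk C from Quotient.sound (.of_isExt ⟨i, j, h⟩))
  have hφ := congrArg φ h
  simp only [φ, K0.lift_cls] at hφ
  have hmk : mk A = mk B := Algebra.GrothendieckAddGroup.of_injective hφ
  exact Quotient.exact hmk

end EqFam

namespace K0

theorem exists_eq_cls_sub_cls (z : K0.{t} k G X) : ∃ A B, z = cls A - cls B := by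
  induction z using K0.induction with
  | zero => exact ⟨EqFam.zero, EqFam.zero, (sub_self _).symm⟩
  | cls A => exact ⟨A, EqFam.zero, by rw [cls_zero, sub_zero]⟩
  | add a b ha hb =>
    obtain ⟨A, B, rfl⟩ := ha
    obtain ⟨A', B', rfl⟩ := hb
    refine ⟨A.prod A', B.prod B', ?_⟩
    rw [EqFam.cls_prod, EqFam.cls_prod, add_sub_add_comm]
  | neg a ha =>
    obtain ⟨A, B, rfl⟩ := ha
    exact ⟨B, A, neg_sub _ _⟩

end K0

end GrothendieckGroup

section ShortExact

variable {k A B C : Type*} [Field k] [AddCommGroup A] [AddCommGroup B] [AddCommGroup C]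
  [Module k A] [Module k B] [Module k C] [FiniteDimensional k A] [FiniteDimensional k B]
  [FiniteDimensional k C]

theorem charpoly_eq_mul_of_exact {i : A →ₗ[k] B} {j : B →ₗ[k] C} (hi : Function.Injective i)
    (hij : Function.Exact i j) (hj : Function.Surjective j) {α : Module.End k A}
    {β : Module.End k B} {γ : Module.End k C} (hα : ∀ a, i (α a) = β (i a))
    (hγ : ∀ b, j (β b) = γ (j b)) : β.charpoly = α.charpoly * γ.charpoly := by
  obtain ⟨s, hs⟩ := j.exists_rightInverse_of_surjective (LinearMap.range_eq_top.2 hj)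
  obtain ⟨e, rfl, rfl⟩ := hij.splitSurjectiveEquiv hi ⟨s, hs⟩
  have map_inl (a) : e.conj β (a, 0) = (α a, 0) := by
    rw [LinearEquiv.conj_apply_apply, ← LinearEquiv.eq_symm_apply]
    exact (hα a).symm
  have map_snd (x) : (e.conj β x).2 = γ x.2 := by
    simpa using hγ (e.symm x)
  let b₁ := Module.finBasis k A
  let b₂ := Module.finBasis k C
  let Φ := LinearMap.toMatrix (b₁.prod b₂) (b₁.prod b₂) (e.conj β)
  have hΦ : Φ = Matrix.fromBlocks (LinearMap.toMatrix b₁ b₁ α) Φ.toBlocks₁₂ 0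
      (LinearMap.toMatrix b₂ b₂ γ) := by
    ext (x | x) (y | y)
    · simp [Φ, LinearMap.toMatrix_apply, map_inl]
    · rfl
    · simp [Φ, LinearMap.toMatrix_apply, map_inl]
    · simp only [Φ, LinearMap.toMatrix_apply, Module.Basis.prod_repr_inr, map_snd]
      simp [LinearMap.toMatrix_apply]
  rw [← LinearEquiv.charpoly_conj e β, ← LinearMap.charpoly_toMatrix _ (b₁.prod b₂),
    ← LinearMap.charpoly_toMatrix α b₁, ← LinearMap.charpoly_toMatrix γ b₂,
    ← Matrix.charpoly_fromBlocks_zero₂₁ _ Φ.toBlocks₁₂, ← hΦ]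

end ShortExact

section Density

variable {R ι : Type*} {M : ι → Type*} [Ring R] [∀ i, AddCommGroup (M i)] [∀ i, Module R (M i)]
  [∀ i, IsSimpleModule R (M i)]

theorem commute_single_proj_of_isSimpleModule [Finite ι] [DecidableEq ι]
    (hM : ∀ i j, i ≠ j → IsEmpty (M i ≃ₗ[R] M j)) (o : ι) (g : Module.End R (∀ i, M i)) :
    Commute g (LinearMap.single R M o ∘ₗ LinearMap.proj o) := by
  have schur : ∀ i j, i ≠ j → LinearMap.proj j ∘ₗ g ∘ₗ LinearMap.single R M i = 0 :=
    fun i j hij => (LinearMap.bijective_or_eq_zero _).resolve_left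
      fun h => (hM i j hij).false (LinearEquiv.ofBijective _ h)
  refine LinearMap.pi_ext fun i m => funext fun j => ?_
  have hg (hij : i ≠ j) : g (Pi.single i m) j = 0 := LinearMap.congr_fun (schur i j hij) m
  rcases eq_or_ne i o with rfl | hi <;> rcases eq_or_ne j i with rfl | hj
  · simp
  · simp [hj, hg hj.symm]
  · simp [hi, hi.symm]
  · rcases eq_or_ne j o with rfl | hjo
    · simp [hg hi, hi.symm]
    · simp [hi.symm, hjo]

theorem exists_smul_eq_single_of_isSimpleModule [Finite ι] [DecidableEq ι]
    [Module.Finite (Module.End R (∀ i, M i)) (∀ i, M i)]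
    (hM : ∀ i j, i ≠ j → IsEmpty (M i ≃ₗ[R] M j)) (o : ι) :
    ∃ a : R, ∀ v : ∀ i, M i, a • v = Pi.single o (v o) := by
  let e : Module.End (Module.End R (∀ i, M i)) (∀ i, M i) :=
    { toFun v := Pi.single o (v o)
      map_add' v w := Pi.single_add o (v o) (w o)
      map_smul' g v := (LinearMap.congr_fun (commute_single_proj_of_isSimpleModule hM o g) v).symm }
  obtain ⟨a, ha⟩ := Module.Finite.toModuleEnd_moduleEnd_surjective (R := R) (M := ∀ i, M i) e
  exact ⟨a, LinearMap.congr_fun ha⟩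

end Density

section VirtualRepresentations

open scoped MonoidAlgebra

variable {k : Type u} {G : Type w} {X : Type x} [Field k] [Group G] [MulAction G X]

namespace EqFam

/-- The subfamily of an equivariant family given by an invariant family of subspaces. -/
def sub (A : EqFam.{t} k G X) (N : ∀ p, Submodule k (A.V p))
    (hN : ∀ (σ : G) {p q : X} (h : σ • p = q), N p ≤ (N q).comap (A.act σ h)) :
    EqFam.{t} k G X where
  V p := N p
  act σ _ _ h := (A.act σ h).restrict (hN σ h)
  act_one p h a := Subtype.ext (A.act_one p h a)
  act_mul τ σ _ _ _ h h' h'' a := Subtype.ext (A.act_mul τ σ h h' h'' a)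

/-- The quotient of an equivariant family by an invariant family of subspaces. -/
def quot (A : EqFam.{t} k G X) (N : ∀ p, Submodule k (A.V p))
    (hN : ∀ (σ : G) {p q : X} (h : σ • p = q), N p ≤ (N q).comap (A.act σ h)) :
    EqFam.{t} k G X where
  V p := A.V p ⧸ N p
  act σ _ _ h := (N _).mapQ (N _) (A.act σ h) (hN σ h)
  act_one p h := (N p).mkQ_surjective.forall.2 fun a => congrArg (N p).mkQ (A.act_one p h a)
  act_mul τ σ p _ r h h' h'' := (N p).mkQ_surjective.forall.2 fun a =>
    congrArg (N r).mkQ (A.act_mul τ σ h h' h'' a)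

theorem isExt_sub_quot (A : EqFam.{t} k G X) (N : ∀ p, Submodule k (A.V p))
    (hN : ∀ (σ : G) {p q : X} (h : σ • p = q), N p ≤ (N q).comap (A.act σ h)) :
    IsExt (A.sub N hN) A (A.quot N hN) :=
  ⟨⟨fun p => (N p).subtype, fun _ _ _ _ _ => rfl⟩, ⟨fun p => (N p).mkQ, fun _ _ _ _ _ => rfl⟩,
    fun p => ⟨(N p).injective_subtype, LinearMap.exact_subtype_mkQ (N p), (N p).mkQ_surjective⟩⟩

/-- An equivariant family over a point, as a representation. -/
def rho (A : EqFam.{t} k G PUnit.{1}) : Representation k G (A.V ⟨⟩) where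
  toFun σ := A.act σ rfl
  map_one' := LinearMap.ext fun a => A.act_one _ _ a
  map_mul' τ σ := LinearMap.ext fun a => (A.act_mul τ σ _ _ _ a).symm

instance (A : EqFam.{t} k G PUnit.{1}) : FiniteDimensional k A.rho.asModule :=
  inferInstanceAs (FiniteDimensional k (A.V ⟨⟩))

theorem Hom.map_asAlgebraHom {A B : EqFam.{t} k G PUnit.{1}} (f : Hom A B) (a : k[G])
    (v : A.V ⟨⟩) : f.map ⟨⟩ (A.rho.asAlgebraHom a v) = B.rho.asAlgebraHom a (f.map ⟨⟩ v) :=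
  (Representation.IntertwiningMap.equivLinearMapAsModule A.rho B.rho
    ⟨f.map ⟨⟩, fun σ => LinearMap.ext fun v => f.comm σ rfl v⟩).map_smul a v

theorem isomorphic_of_asModule_equiv {A B : EqFam.{t} k G PUnit.{1}}
    (e : A.rho.asModule ≃ₗ[k[G]] B.rho.asModule) : Isomorphic A B :=
  let f := (Representation.IntertwiningMap.equivLinearMapAsModule A.rho B.rho).symm e.toLinearMap
  ⟨fun _ => .ofBijective f.toLinearMap e.bijective, fun σ _ _ _ a => f.isIntertwining _ _ σ a⟩

end EqFam

namespace K0

open EqFam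

variable (k G) in
/-- The classes of the irreducible representations. -/
def irreducibleClasses : Set (K0.{t} k G PUnit.{1}) :=
  {z | ∃ S : EqFam.{t} k G PUnit.{1}, S.rho.IsIrreducible ∧ cls S = z}

theorem cls_mem_closure_irreducibleClasses (A : EqFam.{t} k G PUnit.{1}) :
    cls A ∈ AddSubgroup.closure (irreducibleClasses.{t} k G) := by
  induction h : Module.finrank k (A.V ⟨⟩) using Nat.strong_induction_on generalizing A with
  | _ n ih =>
  subst h
  by_cases hA : A.rho.IsIrreducible
  · exact AddSubgroup.subset_closure ⟨A, hA, rfl⟩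
  rcases subsingleton_or_nontrivial (A.V ⟨⟩) with h0 | h0
  · have h : Isomorphic A zero := ⟨fun _ => (0 : A.V ⟨⟩ ≃ₗ[k] PUnit.{t + 1}), fun _ _ _ _ _ => rfl⟩
    rw [h.cls_eq, cls_zero]
    exact zero_mem _
  obtain ⟨N, hbot, htop⟩ :
      ∃ N : Subrepresentation A.rho, N.toSubmodule ≠ ⊥ ∧ N.toSubmodule ≠ ⊤ := by
    by_contra! H
    exact hA
      { exists_pair_ne := ⟨⊥, ⊤, fun h => bot_ne_top (congrArg Subrepresentation.toSubmodule h)⟩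
        eq_bot_or_eq_top N := or_iff_not_imp_left.2 fun hN =>
          Subrepresentation.toSubmodule_injective
            (H N fun h => hN (Subrepresentation.toSubmodule_injective h)) }
  have finrank_quotient_lt {N : Submodule k (A.V ⟨⟩)} (hN : N ≠ ⊥) :
      Module.finrank k (A.V ⟨⟩ ⧸ N) < Module.finrank k (A.V ⟨⟩) := by
    rw [← N.finrank_quotient_add_finrank]
    exact Nat.lt_add_of_pos_right (Submodule.one_le_finrank_iff.2 hN)
  rw [(A.isExt_sub_quot (fun _ => N.toSubmodule)
    fun σ _ _ _ v hv => N.apply_mem_toSubmodule σ hv).cls_eq]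
  exact add_mem (ih _ (Submodule.finrank_lt htop) (A.sub _ _) rfl)
    (ih _ (finrank_quotient_lt hbot) (A.quot _ _) rfl)

theorem closure_irreducibleClasses :
    AddSubgroup.closure (irreducibleClasses.{t} k G) = ⊤ := by
  refine (AddSubgroup.eq_top_iff' _).2 fun z => ?_
  obtain ⟨A, B, rfl⟩ := z.exists_eq_cls_sub_cls
  exact sub_mem (cls_mem_closure_irreducibleClasses A) (cls_mem_closure_irreducibleClasses B)

/-- The algebraic multiplicity of the eigenvalue `1` of an element of the group algebra acting on
a virtual representation. These multiplicities separate the irreducible representations over `ℤ`,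
whereas traces do so only modulo the characteristic of `k`. -/
def eigenMult (a : k[G]) : K0.{t} k G PUnit.{1} →+ ℤ :=
  lift (fun A => ((A.rho.asAlgebraHom a).charpoly.rootMultiplicity 1 : ℤ)) fun A B C i j h => by
    rw [charpoly_eq_mul_of_exact (h ⟨⟩).1 (h ⟨⟩).2.1 (h ⟨⟩).2.2
      (i.map_asAlgebraHom a) (j.map_asAlgebraHom a), Polynomial.rootMultiplicity_mul
      (mul_ne_zero (LinearMap.charpoly_monic _).ne_zero (LinearMap.charpoly_monic _).ne_zero)]
    exact Nat.cast_add _ _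

theorem eigenMult_cls (a : k[G]) (A : EqFam.{t} k G PUnit.{1}) :
    eigenMult a (cls A) = ((A.rho.asAlgebraHom a).charpoly.rootMultiplicity 1 : ℤ) :=
  lift_cls _ _ _

theorem eigenMult_cls_of_smul_eq_zero {a : k[G]} {A : EqFam.{t} k G PUnit.{1}}
    (h : ∀ v : A.rho.asModule, a • v = 0) : eigenMult a (cls A) = 0 := by
  have : A.rho.asAlgebraHom a = 0 := LinearMap.ext h
  rw [eigenMult_cls, this, LinearMap.charpoly_zero, Polynomial.rootMultiplicity_eq_zero,
    Nat.cast_zero]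
  simp

theorem eigenMult_cls_of_smul_eq_self {a : k[G]} {A : EqFam.{t} k G PUnit.{1}}
    (h : ∀ v : A.rho.asModule, a • v = v) :
    eigenMult a (cls A) = Module.finrank k (A.V ⟨⟩) := by
  have : A.rho.asAlgebraHom a = 1 := LinearMap.ext h
  rw [eigenMult_cls, this, LinearMap.charpoly_one, ← Polynomial.C_1,
    Polynomial.rootMultiplicity_X_sub_C_pow]

theorem exists_eigenMult_ne_zero {Z : Finset (K0.{t} k G PUnit.{1})}
    (hZ : ∀ z ∈ Z, z ∈ irreducibleClasses k G) (o : Z) :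
    ∃ a : k[G], eigenMult a o.1 ≠ 0 ∧ ∀ z : Z, z ≠ o → eigenMult a z.1 = 0 := by
  classical
  choose S hS hcls using fun z : Z => hZ z z.2
  let M (z : Z) := (S z).rho.asModule
  have : Module.Finite (Module.End k[G] (∀ z, M z)) (∀ z, M z) :=
    .of_restrictScalars_finite k _ _
  obtain ⟨a, ha⟩ := exists_smul_eq_single_of_isSimpleModule (R := k[G]) (M := M)
    (fun z z' hz => ⟨fun e => hz (Subtype.ext (by
      rw [← hcls, ← hcls, (isomorphic_of_asModule_equiv e).cls_eq]))⟩) o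
  have smul_eq (z) (v : M z) : a • v = Pi.single (M := M) o (Pi.single (M := M) z v o) z := by
    rw [← ha, Pi.smul_apply, Pi.single_eq_same]
  refine ⟨a, ?_, fun z hz => ?_⟩
  · rw [← hcls o, eigenMult_cls_of_smul_eq_self fun v => by simp [smul_eq]]
    have : Nontrivial ((S o).V ⟨⟩) := IsSimpleModule.nontrivial k[G] (S o).rho.asModule
    exact_mod_cast Module.finrank_pos.ne'
  · rw [← hcls z, eigenMult_cls_of_smul_eq_zero fun v => by simp [smul_eq, hz]]

theorem eq_zero_of_eigenMult_eq_zero {z : K0.{t} k G PUnit.{1}} (h : ∀ a, eigenMult a z = 0) :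
    z = 0 := by
  have hz : z ∈ Submodule.span ℤ (irreducibleClasses k G) := by
    rw [← Submodule.mem_toAddSubgroup, Submodule.span_int_eq_addSubgroupClosure,
      closure_irreducibleClasses]
    trivial
  obtain ⟨c, hc, rfl⟩ := Submodule.mem_span_set.1 hz
  suffices c = 0 by rw [this, Finsupp.sum_zero_index]
  by_contra! hne
  obtain ⟨o, ho⟩ := Finsupp.support_nonempty_iff.2 hne
  obtain ⟨a, hao, ha⟩ := exists_eigenMult_ne_zero (fun z hz => hc hz) ⟨o, ho⟩
  have key := h a
  have hsingle (z) (hz : z ∈ c.support) (hzo : z ≠ o) : eigenMult a (c z • z) = 0 := by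
    rw [map_zsmul, ha ⟨z, hz⟩ fun h => hzo (congrArg Subtype.val h), smul_zero]
  rw [Finsupp.sum, map_sum, Finset.sum_eq_single_of_mem o ho hsingle, map_zsmul] at key
  exact (smul_ne_zero (Finsupp.mem_support_iff.1 ho) hao) key

instance : IsAddTorsionFree (K0.{t} k G PUnit.{1}) :=
  Function.Injective.isAddTorsionFree (AddMonoidHom.mk' (fun z a => eigenMult (k := k) (G := G) a z)
      fun _ _ => funext fun _ => map_add _ _ _)
    ((injective_iff_map_eq_zero _).2 fun _ h => eq_zero_of_eigenMult_eq_zero (congrFun h))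

end K0

end VirtualRepresentations

section FiberExt

open MulAction

variable {k : Type u} {G : Type w} {X : Type x} [Field k] [Group G] [MulAction G X]

namespace EqFam

theorem act_act (A : EqFam.{t} k G X) {τ σ υ : G} (hυ : υ = τ * σ) {p q r : X} (h : σ • p = q)
    (h' : τ • q = r) (h'' : υ • p = r) (a : A.V p) :
    A.act τ h' (A.act σ h a) = A.act υ h'' a := by
  subst hυ
  exact A.act_mul τ σ h h' h'' a

/-- The representation of the stabilizer of `p` on the member `V p` of a family. -/
abbrev stabFiber (A : EqFam.{t} k G X) (p : X) : EqFam.{t} k (stabilizer G p) PUnit.{1} :=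
  A.fiber p (stabilizer G p) fun _ => mem_stabilizer_iff.1

/-- The action of `σ`, where `σ • p = p' = p`, on a representation `F p` of the stabilizer of `p`.
Keeping `p'` distinct from `p` avoids casts between the equal types `(F p).V ⟨⟩` and
`(F p').V ⟨⟩`. -/
def transport (F : ∀ p, EqFam.{t} k (stabilizer G p) PUnit.{1}) {p p' : X} (e : p = p') (σ : G)
    (h : σ • p = p') : (F p).V ⟨⟩ →ₗ[k] (F p').V ⟨⟩ := by
  subst e
  exact (F p).act ⟨σ, mem_stabilizer_iff.2 h⟩ rfl

theorem transport_eq_self (F : ∀ p, EqFam.{t} k (stabilizer G p) PUnit.{1}) {p : X} {σ : G}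
    (h : σ • p = p) (hσ : σ = 1) (a) : transport F rfl σ h a = a := by
  subst hσ
  exact (F p).act_one _ _ a

theorem transport_transport (F : ∀ p, EqFam.{t} k (stabilizer G p) PUnit.{1}) {p q r : X}
    (e : p = q) (e' : q = r) {τ σ υ : G} (h : σ • p = q) (h' : τ • q = r) (h'' : υ • p = r)
    (hυ : υ = τ * σ) (a) :
    transport F e' τ h' (transport F e σ h a) = transport F (e.trans e') υ h'' a := by
  subst e e' hυ
  exact (F p).act_mul _ _ _ _ _ a

theorem map_transport {F F' : ∀ p, EqFam.{t} k (stabilizer G p) PUnit.{1}}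
    (f : ∀ p, Hom (F p) (F' p)) {p q : X} (e : p = q) (σ : G) (h : σ • p = q) (a) :
    (f q).map ⟨⟩ (transport F e σ h a) = transport F' e σ h ((f p).map ⟨⟩ a) := by
  subst e
  exact (f p).comm _ _ a

theorem transport_stabFiber (A : EqFam.{t} k G X) {p q : X} (e : p = q) (σ : G) (h : σ • p = q)
    (a) : transport A.stabFiber e σ h a = A.act σ h a := by
  subst e
  rfl

variable (G) in
/-- A chosen point in the orbit of `p`. -/
def orbitRep (p : X) : X := (Quotient.mk (orbitRel G X) p).out

theorem orbitRep_eq_of_smul_eq {σ : G} {p q : X} (h : σ • p = q) : orbitRep G p = orbitRep G q :=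
  congrArg Quotient.out (Quotient.sound (s := orbitRel G X) ⟨σ⁻¹, inv_smul_eq_iff.2 h.symm⟩)

theorem exists_smul_orbitRep (p : X) : ∃ σ : G, σ • orbitRep G p = p :=
  (orbitRel G X).symm (Quotient.mk_out (s := orbitRel G X) p)

variable (G) in
/-- A chosen group element moving `orbitRep G p` to `p`. -/
def orbitMover (p : X) : G := (exists_smul_orbitRep p).choose

theorem orbitMover_smul (p : X) : orbitMover G p • orbitRep G p = p :=
  (exists_smul_orbitRep p).choose_spec

theorem orbitMover_conj_smul {σ : G} {p q : X} (h : σ • p = q) :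
    ((orbitMover G q)⁻¹ * σ * orbitMover G p) • orbitRep G p = orbitRep G q := by
  rw [mul_smul, mul_smul, orbitMover_smul, h, inv_smul_eq_iff, orbitMover_smul]

/-- The equivariant family spread out along the orbits from the representations `F p` at the
chosen points of the orbits; the other representations `F p` are ignored. -/
def ofOrbits (F : ∀ p : X, EqFam.{t} k (stabilizer G p) PUnit.{1}) : EqFam.{t} k G X where
  V p := (F (orbitRep G p)).V ⟨⟩
  act σ p q h := transport F (orbitRep_eq_of_smul_eq h)
    ((orbitMover G q)⁻¹ * σ * orbitMover G p) (orbitMover_conj_smul h)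
  act_one p h a := transport_eq_self F _ (by group) a
  act_mul τ σ p q r h h' h'' a := transport_transport F _ _ _ _ _ (by group) a

theorem IsExt.ofOrbits {A E C : ∀ p : X, EqFam.{t} k (stabilizer G p) PUnit.{1}}
    (h : ∀ p, IsExt (A p) (E p) (C p)) : IsExt (ofOrbits A) (ofOrbits E) (ofOrbits C) := by
  choose i j h using h
  exact ⟨⟨fun p => (i (orbitRep G p)).map ⟨⟩, fun σ p q _ a => map_transport i _ _ _ a⟩,
    ⟨fun p => (j (orbitRep G p)).map ⟨⟩, fun σ p q _ a => map_transport j _ _ _ a⟩,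
    fun p => h (orbitRep G p) ⟨⟩⟩

theorem isomorphic_ofOrbits_stabFiber (A : EqFam.{t} k G X) :
    Isomorphic (ofOrbits A.stabFiber) A := by
  have hinv (p : X) : (orbitMover G p)⁻¹ • p = orbitRep G p := by
    rw [inv_smul_eq_iff, orbitMover_smul]
  refine ⟨fun p => LinearEquiv.ofBijective (A.act (orbitMover G p) (orbitMover_smul p))
    (Function.bijective_iff_has_inverse.2 ⟨A.act (orbitMover G p)⁻¹ (hinv p), fun a => ?_,
      fun a => ?_⟩), fun σ p q h a => ?_⟩
  · rw [A.act_act (υ := 1) (by group) _ _ (one_smul _ _), A.act_one]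
  · rw [A.act_act (υ := 1) (by group) _ _ (one_smul _ _), A.act_one]
  · have hq : (σ * orbitMover G p) • orbitRep G p = q := by rw [mul_smul, orbitMover_smul, h]
    calc A.act (orbitMover G q) _ (transport A.stabFiber _ _ (orbitMover_conj_smul h) a)
      _ = A.act (orbitMover G q) _ (A.act _ (orbitMover_conj_smul h) a) :=
        congrArg _ (transport_stabFiber A _ _ _ a)
      _ = A.act (σ * orbitMover G p) hq a := A.act_act (by group) _ _ _ a
      _ = A.act σ h (A.act (orbitMover G p) _ a) := (A.act_act rfl _ _ _ a).symm

theorem cls_add_cls_ofOrbits {D : EqFam.{t} k G X}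
    {A Z C : ∀ p : X, EqFam.{t} k (stabilizer G p) PUnit.{1}}
    (h : ∀ p, IsExt (A p) ((D.stabFiber p).prod (Z p)) (C p)) :
    K0.cls D + K0.cls (ofOrbits Z) = K0.cls (ofOrbits A) + K0.cls (ofOrbits C) := by
  rw [← (IsExt.ofOrbits h).cls_eq,
    (IsExt.ofOrbits fun p => isExt_prod (D.stabFiber p) (Z p)).cls_eq,
    (isomorphic_ofOrbits_stabFiber D).cls_eq]

variable {ι : Type*} {r : X → ι} (hr : ∀ (σ : G) p, r (σ • p) = r p)

/-- The action of `σ` on a collection of equivariant families, where `m = n`. -/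
def actOfEq (F : ι → EqFam.{t} k G X) {m n : ι} (e : m = n) (σ : G) {p q : X} (h : σ • p = q) :
    (F m).V p →ₗ[k] (F n).V q := by
  subst e
  exact (F m).act σ h

theorem actOfEq_actOfEq (F : ι → EqFam.{t} k G X) {l m n : ι} (e : l = m) (e' : m = n) (τ σ : G)
    {p q s : X} (h : σ • p = q) (h' : τ • q = s) (h'' : (τ * σ) • p = s) (a) :
    actOfEq F e' τ h' (actOfEq F e σ h a) = actOfEq F (e.trans e') (τ * σ) h'' a := by
  subst e e'
  exact (F l).act_mul τ σ h h' h'' a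

/-- The family whose member at `p` is that of `F (r p)`, for an invariant function `r`. -/
def glue (F : ι → EqFam.{t} k G X) : EqFam.{t} k G X where
  V p := (F (r p)).V p
  act σ p q h := actOfEq F (by rw [← h, hr]) σ h
  act_one p h a := (F (r p)).act_one p h a
  act_mul τ σ p q s h h' h'' a := actOfEq_actOfEq F _ _ τ σ h h' h'' a

theorem isomorphic_fiber_glue (F : ι → EqFam.{t} k G X) (p : X) (H : Subgroup G)
    (hH : ∀ σ ∈ H, σ • p = p) : Isomorphic ((glue hr F).fiber p H hH) ((F (r p)).fiber p H hH) :=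
  ⟨fun _ => LinearEquiv.refl k _, fun _ _ _ _ _ => rfl⟩

end EqFam

namespace K0

/-- Restriction to the member at `p`, as a virtual representation of the stabilizer of `p`. -/
abbrev stabFiber (p : X) : K0.{t} k G X →+ K0.{t} k (stabilizer G p) PUnit.{1} :=
  fiber p (stabilizer G p) fun _ => mem_stabilizer_iff.1

theorem fiber_cls (p : X) (H : Subgroup G) (hH : ∀ σ ∈ H, σ • p = p) (A : EqFam.{t} k G X) :
    fiber p H hH (cls A) = cls (A.fiber p H hH) := lift_cls _ _ _

theorem fiber_cls_eq_zero (p : X) (H : Subgroup G) (hH : ∀ σ ∈ H, σ • p = p)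
    (A : EqFam.{t} k G X) [Subsingleton (A.V p)] : fiber p H hH (cls A) = 0 := by
  have h : EqFam.Isomorphic (A.fiber p H hH) EqFam.zero :=
    ⟨fun _ => (0 : A.V p ≃ₗ[k] PUnit.{t + 1}), fun _ _ _ _ _ => rfl⟩
  rw [fiber_cls, h.cls_eq, cls_zero]

theorem fiber_cls_glue {ι : Type*} {r : X → ι} (hr : ∀ (σ : G) p, r (σ • p) = r p)
    (F : ι → EqFam.{t} k G X) (p : X) (H : Subgroup G) (hH : ∀ σ ∈ H, σ • p = p) :
    fiber p H hH (cls (EqFam.glue hr F)) = fiber p H hH (cls (F (r p))) := by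
  rw [fiber_cls, fiber_cls, (EqFam.isomorphic_fiber_glue hr F p H hH).cls_eq]

/-- Heller's criterion provides the witnesses for `fiber p z = 0` in terms of actual
representations, which can be spread out along the orbits. -/
theorem eq_zero_of_fiber_eq_zero {z : K0.{t} k G X}
    (hz : ∀ p : X, stabFiber p z = 0) : z = 0 := by
  obtain ⟨A, B, rfl⟩ := z.exists_eq_cls_sub_cls
  have hAB (p : X) : cls (A.stabFiber p) = cls (B.stabFiber p) := by
    simpa only [map_sub, sub_eq_zero, fiber_cls] using hz p
  choose E C Z hA hB using fun p => EqFam.hellerRel_of_cls_eq (hAB p)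
  rw [sub_eq_zero]
  exact add_right_cancel
    ((EqFam.cls_add_cls_ofOrbits hA).trans (EqFam.cls_add_cls_ofOrbits hB).symm)

theorem exists_fiber_eq_fiber {ι : Type*} {r : X → ι} (hr : ∀ (σ : G) p, r (σ • p) = r p)
    (z : ι → K0.{t} k G X) : ∃ y : K0.{t} k G X, ∀ (p : X) (H : Subgroup G)
      (hH : ∀ σ ∈ H, σ • p = p), fiber p H hH y = fiber p H hH (z (r p)) := by
  choose A B h using fun i => (z i).exists_eq_cls_sub_cls
  refine ⟨cls (EqFam.glue hr A) - cls (EqFam.glue hr B), fun p H hH => ?_⟩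
  rw [h, map_sub, map_sub, fiber_cls_glue, fiber_cls_glue]

theorem exists_eq_cls_sub_cls_of_support {S : Set X} (hS : ∀ (σ : G) p, σ • p ∈ S ↔ p ∈ S)
    {z : K0.{t} k G X} (hz : ∀ p ∉ S, stabFiber p z = 0) :
    ∃ A B, z = cls A - cls B ∧ ∀ p ∉ S, Subsingleton (A.V p) ∧ Subsingleton (B.V p) := by
  classical
  obtain ⟨A, B, rfl⟩ := z.exists_eq_cls_sub_cls
  have hS' (σ : G) (p : X) : (σ • p ∈ S) = (p ∈ S) := propext (hS σ p)
  let restrict (A : EqFam.{t} k G X) : EqFam.{t} k G X :=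
    EqFam.glue hS' fun s : Prop => if s then A else EqFam.zero
  have subsingleton_restrict (A) {p : X} (hp : p ∉ S) : Subsingleton ((restrict A).V p) := by
    change Subsingleton ((if p ∈ S then A else EqFam.zero).V p)
    rw [if_neg hp]
    exact inferInstanceAs (Subsingleton PUnit)
  refine ⟨restrict A, restrict B, sub_eq_zero.1 (eq_zero_of_fiber_eq_zero fun p => ?_),
    fun p hp => ⟨subsingleton_restrict A hp, subsingleton_restrict B hp⟩⟩
  rw [map_sub, sub_eq_zero]
  by_cases hp : p ∈ S
  · have fiber_restrict (A) : stabFiber p (cls (restrict A)) = stabFiber p (cls A) := by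
      rw [stabFiber, fiber_cls_glue, if_pos hp]
    rw [map_sub, map_sub, fiber_restrict, fiber_restrict]
  · have := subsingleton_restrict A hp
    have := subsingleton_restrict B hp
    rw [hz p hp, map_sub, fiber_cls_eq_zero, fiber_cls_eq_zero, sub_zero]

end K0

end FiberExt

section IncidenceAlgebra

open Finset

variable {k : Type u} {W : Type w} {P : Type v} [Field k] [Group W] [PartialOrder P]
  [PosetAction W P]

theorem Intv.stabilizer_eq_stab (p : Intv P) : MulAction.stabilizer W p = p.stab W :=
  Subgroup.ext fun _ => Intv.ext_iff

theorem WeakRank.r_self (r : WeakRank W P) (x : P) : r.r ⟨x, x, le_rfl⟩ = 0 :=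
  Nat.add_eq_left.1 (r.add (le_refl x) (le_refl x))

variable [LocallyFiniteOrder P] {r : WeakRank W P}

namespace IncAlg

theorem comp_eq_zero_iff {p : Intv P} {a : IncAlg k W P} : comp p a = 0 ↔ K0.stabFiber p a = 0 := by
  have fiber_eq_zero_congr {H H' : Subgroup W} (e : H = H') (hH : ∀ σ ∈ H, σ • p = p)
      (hH' : ∀ σ ∈ H', σ • p = p) : K0.fiber p H hH a = 0 ↔ K0.fiber p H' hH' a = 0 := by
    subst e
    rfl
  exact fiber_eq_zero_congr p.stabilizer_eq_stab.symm _ _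

theorem ext_comp {a b : IncAlg k W P} (h : ∀ p, comp p a = comp p b) : a = b :=
  sub_eq_zero.1 (K0.eq_zero_of_fiber_eq_zero fun p =>
    comp_eq_zero_iff.1 (by rw [map_sub, h, sub_self]))

theorem comp_one_of_lt {p : Intv P} (hp : p.lo < p.hi) : comp p (1 : IncAlg k W P) = 0 := by
  have : IsEmpty (ULift.{v} (PLift (p.lo = p.hi))) := ⟨fun e => hp.ne e.down.down⟩
  have : Subsingleton ((EqFam.unit : EqFam k W (Intv P)).V p) :=
    inferInstanceAs (Subsingleton (ULift.{v} (PLift (p.lo = p.hi)) → k))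
  exact K0.fiber_cls_eq_zero p _ _ _

variable (r) in
/-- The element of the incidence algebra which agrees with `z m` on the intervals of rank `m`. -/
def rankGlue : (ℕ → IncAlg k W P) →+ IncAlg k W P where
  toFun z := (K0.exists_fiber_eq_fiber r.inv z).choose
  map_zero' := ext_comp fun p => (K0.exists_fiber_eq_fiber r.inv 0).choose_spec p _ _
  map_add' y z := ext_comp fun p => by
    have hglue (z : ℕ → IncAlg k W P) :
        comp p (K0.exists_fiber_eq_fiber r.inv z).choose = comp p (z (r.r p)) :=
      (K0.exists_fiber_eq_fiber r.inv z).choose_spec p _ _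
    rw [map_add, hglue, hglue, hglue, Pi.add_apply, map_add]

@[simp]
theorem comp_rankGlue (z : ℕ → IncAlg k W P) (p : Intv P) :
    comp p (rankGlue r z) = comp p (z (r.r p)) :=
  (K0.exists_fiber_eq_fiber r.inv z).choose_spec p _ _

variable (r) in
/-- The part of an element of the incidence algebra supported on the intervals of rank `m`. -/
def rankPart (m : ℕ) : IncAlg k W P →+ IncAlg k W P :=
  (rankGlue r).comp (AddMonoidHom.single (fun _ => IncAlg k W P) m)

theorem comp_rankPart (m : ℕ) (a : IncAlg k W P) (p : Intv P) :
    comp p (rankPart r m a) = if r.r p = m then comp p a else 0 := by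
  rw [rankPart, AddMonoidHom.comp_apply, comp_rankGlue, AddMonoidHom.single_apply, Pi.single_apply]
  split_ifs
  · rfl
  · exact map_zero _

theorem comp_cls_mul_cls_eq_zero {A B : EqFam.{max u v} k W (Intv P)} {p : Intv P}
    (h : ∀ y : Set.Icc p.lo p.hi, Subsingleton (A.V (p.left y)) ∨ Subsingleton (B.V (p.right y))) :
    comp p (K0.cls A * K0.cls B) = 0 := by
  have (y : Set.Icc p.lo p.hi) : Subsingleton (A.V (p.left y) ⊗[k] B.V (p.right y)) := by
    obtain h | h := h y <;> infer_instance
  have : Subsingleton ((A.tensor B).V p) := inferInstanceAs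
    (Subsingleton (⨁ y : Set.Icc p.lo p.hi, A.V (p.left y) ⊗[k] B.V (p.right y)))
  exact (congrArg (comp p) (mulHom_cls A B)).trans (K0.fiber_cls_eq_zero p _ _ _)

theorem exists_eq_cls_sub_cls_of_rank_support {M : Set ℕ} {a : IncAlg k W P}
    (ha : ∀ p, r.r p ∉ M → comp p a = 0) :
    ∃ A B : EqFam.{max u v} k W (Intv P), a = (K0.cls A - K0.cls B : IncAlg k W P) ∧
      ∀ p, r.r p ∉ M → Subsingleton (A.V p) ∧ Subsingleton (B.V p) :=
  K0.exists_eq_cls_sub_cls_of_support (S := r.r ⁻¹' M)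
    (fun σ p => by rw [Set.mem_preimage, r.inv, Set.mem_preimage])
    fun p hp => comp_eq_zero_iff.1 (ha p hp)

theorem comp_mul_eq_zero {M N : Set ℕ} {a b : IncAlg k W P}
    (ha : ∀ p, r.r p ∉ M → comp p a = 0) (hb : ∀ p, r.r p ∉ N → comp p b = 0) {p : Intv P}
    (hp : ∀ m ∈ M, ∀ n ∈ N, m + n ≠ r.r p) : comp p (a * b) = 0 := by
  obtain ⟨A, A', rfl, hA⟩ := exists_eq_cls_sub_cls_of_rank_support ha
  obtain ⟨B, B', rfl, hB⟩ := exists_eq_cls_sub_cls_of_rank_support hb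
  have comp_cls_mul_cls {C D : EqFam.{max u v} k W (Intv P)}
      (hC : ∀ q, r.r q ∉ M → Subsingleton (C.V q)) (hD : ∀ q, r.r q ∉ N → Subsingleton (D.V q)) :
      comp p (K0.cls C * K0.cls D) = 0 := by
    refine comp_cls_mul_cls_eq_zero fun y => ?_
    by_cases hy : r.r (p.left y) ∈ M
    · exact .inr (hD _ fun hy' => hp _ hy _ hy' (r.add y.2.1 y.2.2))
    · exact .inl (hC _ hy)
  simp only [sub_mul, mul_sub, map_sub, sub_zero,
    comp_cls_mul_cls (fun q h => (hA q h).1) fun q h => (hB q h).1,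
    comp_cls_mul_cls (fun q h => (hA q h).1) fun q h => (hB q h).2,
    comp_cls_mul_cls (fun q h => (hA q h).2) fun q h => (hB q h).1,
    comp_cls_mul_cls (fun q h => (hA q h).2) fun q h => (hB q h).2]

theorem comp_mul_eq_sum_rankPart_mul (a b : IncAlg k W P) (p : Intv P) :
    comp p (a * b) = ∑ i ∈ range (r.r p + 1), comp p (rankPart r i a * b) := by
  have hsupp (q : Intv P) (hq : r.r q ∉ Set.Ioi (r.r p)) :
      comp q (a - ∑ i ∈ range (r.r p + 1), rankPart r i a) = 0 := by
    have hq' : r.r q < r.r p + 1 := Order.lt_add_one_iff.2 (not_lt.1 hq)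
    simp only [map_sub, map_sum, comp_rankPart, sum_ite_eq, mem_range, if_pos hq', sub_self]
  have hcomp := comp_mul_eq_zero (b := b) (N := Set.univ) hsupp (fun _ h => (h trivial).elim)
    (p := p) fun m hm n _ => by have := Set.mem_Ioi.1 hm; omega
  rwa [sub_mul, map_sub, sub_eq_zero, sum_mul, map_sum] at hcomp

theorem comp_rankPart_mul {i j : ℕ} {p : Intv P} (h : i + j = r.r p) (a b : IncAlg k W P) :
    comp p (rankPart r i a * b) = comp p (rankPart r i a * rankPart r j b) := by
  rw [← sub_eq_zero, ← map_sub, ← mul_sub]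
  refine comp_mul_eq_zero (r := r) (M := {i}) (N := {j}ᶜ) (fun q (hq : r.r q ≠ i) => ?_)
    (fun q (hq : ¬ (r.r q ≠ j)) => ?_) ?_
  · rw [comp_rankPart, if_neg hq]
  · rw [map_sub, comp_rankPart, if_pos (not_not.1 hq), sub_self]
  · rintro _ rfl n (hn : n ≠ j)
    omega

theorem comp_mul (a b : IncAlg k W P) (p : Intv P) :
    comp p (a * b) =
      ∑ ij ∈ antidiagonal (r.r p), comp p (rankPart r ij.1 a * rankPart r ij.2 b) := by
  rw [comp_mul_eq_sum_rankPart_mul (r := r), ← Nat.sum_antidiagonal_eq_sum_range_succ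
    fun i _ => comp p (rankPart r i a * b)]
  exact sum_congr rfl fun ij hij => comp_rankPart_mul (mem_antidiagonal.1 hij) a b

end IncAlg

end IncidenceAlgebra

section PowerSeries

open Finset IncAlg

open PowerSeries (coeff)

open scoped Polynomial

variable {k : Type u} {W : Type w} {P : Type v} [Field k] [Group W] [PartialOrder P]
  [PosetAction W P] [LocallyFiniteOrder P]

section coeffAt

variable (f g : PowerSeries (IncAlg k W P)) (p : Intv P) (n : ℕ)

@[simp]
theorem coeffAt_zero : coeffAt (0 : PowerSeries (IncAlg k W P)) p n = 0 := by simp [coeffAt]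

@[simp]
theorem coeffAt_add : coeffAt (f + g) p n = coeffAt f p n + coeffAt g p n := by simp [coeffAt]

@[simp]
theorem coeffAt_neg : coeffAt (-f) p n = -coeffAt f p n := by simp [coeffAt]

@[simp]
theorem coeffAt_sub : coeffAt (f - g) p n = coeffAt f p n - coeffAt g p n := by simp [coeffAt]

variable {f g}

theorem ext_coeffAt (h : ∀ p n, coeffAt f p n = coeffAt g p n) : f = g :=
  PowerSeries.ext fun n => ext_comp fun p => h p n

variable {p} in
theorem coeffAt_one_of_lt (hp : p.lo < p.hi) :
    coeffAt (1 : PowerSeries (IncAlg k W P)) p n = 0 := by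
  rw [coeffAt, PowerSeries.coeff_one]
  split_ifs
  · exact comp_one_of_lt hp
  · exact map_zero _

end coeffAt

variable (r : WeakRank W P)

/-- The power series whose component at each interval of rank `m` has the coefficients of
`∑ₙ c m n t ^ n`. -/
def mkRank (c : ℕ → ℕ → IncAlg k W P) : PowerSeries (IncAlg k W P) :=
  PowerSeries.mk fun n => rankGlue r fun m => c m n

variable {r} in
@[simp]
theorem coeffAt_mkRank (c : ℕ → ℕ → IncAlg k W P) (p : Intv P) (n : ℕ) :
    coeffAt (mkRank r c) p n = comp p (c (r.r p) n) := by
  rw [coeffAt, mkRank, PowerSeries.coeff_mk, comp_rankGlue]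

/-- The bar operation `f ↦ \bar f`. On arbitrary power series, the part of `f_{xy}(t)` of degree
greater than `r_{xy}` is discarded. -/
def bar : PowerSeries (IncAlg k W P) →+ PowerSeries (IncAlg k W P) where
  toFun f := mkRank r fun m n => if n ≤ m then coeff (m - n) f else 0
  map_zero' := ext_coeffAt fun p n => by simp
  map_add' f g := ext_coeffAt fun p n => by
    simp only [coeffAt_mkRank, coeffAt_add, map_add]
    split_ifs <;> simp

section bar

variable {r} {f g : PowerSeries (IncAlg k W P)}

theorem coeffAt_bar (f : PowerSeries (IncAlg k W P)) (p : Intv P) (n : ℕ) :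
    coeffAt (bar r f) p n = if n ≤ r.r p then coeffAt f p (r.r p - n) else 0 := by
  rw [bar, AddMonoidHom.coe_mk, ZeroHom.coe_mk, coeffAt_mkRank]
  split_ifs
  · rfl
  · exact map_zero _

theorem isBar_iff : IsBar r f g ↔ bar r f = g :=
  ⟨fun h => ext_coeffAt fun p n => (coeffAt_bar f p n).trans (h p n).symm,
    fun h p n => h ▸ coeffAt_bar f p n⟩

theorem bar_mem_scriptI (f : PowerSeries (IncAlg k W P)) : bar r f ∈ scriptI r := fun p n h => by
  rw [coeffAt_bar, if_neg h.not_ge]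

theorem bar_bar (hf : f ∈ scriptI r) : bar r (bar r f) = f := ext_coeffAt fun p n => by
  rw [coeffAt_bar, coeffAt_bar]
  split_ifs with h
  · rw [Nat.sub_sub_self h]
  · omega
  · rw [hf p n (by omega)]

end bar

/-- The polynomial of degree at most `i` formed by the components of `f ∈ 𝓘^W(P)` at the intervals
of rank `i`. On it, the bar operation is the reversal of the coefficients. -/
def rankPoly (i : ℕ) (f : PowerSeries (IncAlg k W P)) : (IncAlg k W P)[X] :=
  PowerSeries.trunc (i + 1) (PowerSeries.mk fun n => rankPart r i (coeff n f))

section rankPoly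

variable {r} {f g : PowerSeries (IncAlg k W P)}

theorem natDegree_rankPoly_le (i : ℕ) (f : PowerSeries (IncAlg k W P)) :
    (rankPoly r i f).natDegree ≤ i :=
  Nat.lt_succ_iff.1 (PowerSeries.natDegree_trunc_lt _ i)

theorem coeff_rankPoly (hf : f ∈ scriptI r) (i n : ℕ) :
    (rankPoly r i f).coeff n = rankPart r i (coeff n f) := by
  rw [rankPoly, PowerSeries.coeff_trunc, PowerSeries.coeff_mk, ite_eq_left_iff]
  refine fun hn => ext_comp fun p => ?_
  rw [comp_rankPart, map_zero, eq_comm, ite_eq_right_iff]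
  exact fun hp => hf p n (by omega)

theorem rankPoly_bar (i : ℕ) (f : PowerSeries (IncAlg k W P)) :
    rankPoly r i (bar r f) = (rankPoly r i f).reflect i := by
  refine Polynomial.ext fun n => ext_comp fun p => ?_
  rw [Polynomial.coeff_reflect, coeff_rankPoly (bar_mem_scriptI f), comp_rankPart, rankPoly,
    PowerSeries.coeff_trunc, PowerSeries.coeff_mk]
  change (if r.r p = i then coeffAt (bar r f) p n else 0) = _
  rw [coeffAt_bar]
  obtain hn | hn := le_or_gt n i
  · rw [Polynomial.revAt_le hn, if_pos (show i - n < i + 1 by omega), comp_rankPart]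
    split_ifs with hp hnp
    · rw [hp, coeffAt]
    · omega
    · rfl
  · rw [Polynomial.revAt_eq_self_of_lt hn, if_neg (show ¬ n < i + 1 by omega), map_zero,
      ite_eq_right_iff]
    exact fun hp => if_neg (by omega)

theorem coeffAt_mul (hf : f ∈ scriptI r) (hg : g ∈ scriptI r) (p : Intv P) (n : ℕ) :
    coeffAt (f * g) p n =
      ∑ ij ∈ antidiagonal (r.r p), comp p ((rankPoly r ij.1 f * rankPoly r ij.2 g).coeff n) := by
  simp only [coeffAt, PowerSeries.coeff_mul, Polynomial.coeff_mul, map_sum, coeff_rankPoly hf,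
    coeff_rankPoly hg]
  rw [sum_comm]
  exact sum_congr rfl fun _ _ => comp_mul _ _ p

theorem mul_mem_scriptI (hf : f ∈ scriptI r) (hg : g ∈ scriptI r) : f * g ∈ scriptI r := by
  intro p n hn
  rw [coeffAt_mul hf hg]
  refine sum_eq_zero fun ij hij => ?_
  rw [Polynomial.coeff_eq_zero_of_natDegree_lt, map_zero]
  calc (rankPoly r ij.1 f * rankPoly r ij.2 g).natDegree
    _ ≤ ij.1 + ij.2 := Polynomial.natDegree_mul_le_of_le (natDegree_rankPoly_le _ f)
        (natDegree_rankPoly_le _ g)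
    _ = r.r p := mem_antidiagonal.1 hij
    _ < n := hn

theorem bar_mul (hf : f ∈ scriptI r) (hg : g ∈ scriptI r) :
    bar r (f * g) = bar r f * bar r g := by
  refine ext_coeffAt fun p n => ?_
  have hrefl {ij : ℕ × ℕ} (hij : ij ∈ antidiagonal (r.r p)) :
      rankPoly r ij.1 (bar r f) * rankPoly r ij.2 (bar r g) =
        (rankPoly r ij.1 f * rankPoly r ij.2 g).reflect (r.r p) := by
    rw [← mem_antidiagonal.1 hij, Polynomial.reflect_mul _ _ (natDegree_rankPoly_le _ f)
      (natDegree_rankPoly_le _ g), rankPoly_bar, rankPoly_bar]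
  rw [coeffAt_mul (bar_mem_scriptI f) (bar_mem_scriptI g), coeffAt_bar,
    sum_congr rfl fun ij hij => by rw [hrefl hij, Polynomial.coeff_reflect],
    ← coeffAt_mul hf hg]
  obtain hn | hn := le_or_gt n (r.r p)
  · rw [if_pos hn, Polynomial.revAt_le hn]
  · rw [if_neg hn.not_ge, Polynomial.revAt_eq_self_of_lt hn, mul_mem_scriptI hf hg p n hn]

end rankPoly

/-- The power series whose components vanish at the intervals of rank less than `m`. -/
def rankFiltration (m : ℕ) : AddSubgroup (PowerSeries (IncAlg k W P)) where
  carrier := {f | ∀ p n, r.r p < m → coeffAt f p n = 0}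
  zero_mem' p n _ := coeffAt_zero p n
  add_mem' hf hg p n h := by rw [coeffAt_add, hf p n h, hg p n h, add_zero]
  neg_mem' hf p n h := by rw [coeffAt_neg, hf p n h, neg_zero]

/-- The power series with `f_{xx} = 0` for all `x` and `deg f_{xy}(t) < r_{xy} / 2` for all
`x < y`, so that `𝓘^W_{1/2}(P) = 1 + lowDegree r`. -/
def lowDegree : AddSubgroup (PowerSeries (IncAlg k W P)) where
  carrier := {f | ∀ p n, r.r p ≤ 2 * n → coeffAt f p n = 0}
  zero_mem' p n _ := coeffAt_zero p n
  add_mem' hf hg p n h := by rw [coeffAt_add, hf p n h, hg p n h, add_zero]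
  neg_mem' hf p n h := by rw [coeffAt_neg, hf p n h, neg_zero]

section filtration

variable {r} {f g : PowerSeries (IncAlg k W P)} {m : ℕ}

theorem mem_scriptIHalf_iff : f ∈ scriptIHalf r ↔ f - 1 ∈ lowDegree r := by
  refine ⟨fun ⟨hdiag, hlow⟩ p n hn => ?_, fun h => ⟨fun x n => ?_, fun p n hp hn => ?_⟩⟩
  · obtain hp | hp := p.le.lt_or_eq
    · rw [coeffAt_sub, hlow p n hp hn, coeffAt_one_of_lt n hp, sub_zero]
    · obtain ⟨x, y, h⟩ := p
      obtain rfl : x = y := hp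
      rw [coeffAt_sub, hdiag, sub_self]
  · rw [← sub_eq_zero, ← coeffAt_sub]
    exact h _ n (by rw [r.r_self]; omega)
  · have hpn := h p n hn
    rwa [coeffAt_sub, coeffAt_one_of_lt n hp, sub_zero] at hpn

theorem mem_scriptI_of_mem_lowDegree (hf : f ∈ lowDegree r) : f ∈ scriptI r :=
  fun p n hn => hf p n (by omega)

theorem sub_one_mem_rankFiltration_one (hf : DiagOne f) : f - 1 ∈ rankFiltration r 1 := by
  rintro ⟨x, y, h⟩ n hn
  obtain rfl | hxy := h.eq_or_lt
  · rw [coeffAt_sub, hf, sub_self]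
  · exact absurd (r.pos ⟨x, y, h⟩ hxy) (by omega)

theorem mul_mem_rankFiltration {a b : ℕ} (hf : f ∈ rankFiltration r a)
    (hg : g ∈ rankFiltration r b) : f * g ∈ rankFiltration r (a + b) := by
  intro p n hp
  rw [coeffAt, PowerSeries.coeff_mul, map_sum]
  refine sum_eq_zero fun ij _ => comp_mul_eq_zero (M := Set.Ici a) (N := Set.Ici b)
    (fun q hq => hf q _ (not_le.1 hq)) (fun q hq => hg q _ (not_le.1 hq)) ?_
  rintro i (hi : a ≤ i) j (hj : b ≤ j)
  omega

theorem bar_mem_rankFiltration (hf : f ∈ rankFiltration r m) : bar r f ∈ rankFiltration r m := by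
  intro p n hp
  rw [coeffAt_bar, hf p _ hp, ite_self]

theorem mem_rankFiltration_succ_iff (hf : f ∈ rankFiltration r m) :
    f ∈ rankFiltration r (m + 1) ↔ ∀ p n, r.r p = m → coeffAt f p n = 0 :=
  ⟨fun h p n hp => h p n (by omega), fun h p n hp =>
    (Nat.lt_succ_iff_lt_or_eq.1 hp).elim (hf p n) (h p n)⟩

theorem exists_limit_rankFiltration {s : ℕ → PowerSeries (IncAlg k W P)}
    (hs : ∀ m, s m ∈ lowDegree r) (hcauchy : ∀ m, s (m + 1) - s m ∈ rankFiltration r m) :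
    ∃ f ∈ lowDegree r, ∀ m, f - s m ∈ rankFiltration r m := by
  have hlim (p : Intv P) (n : ℕ) :
      coeffAt (mkRank r fun m n => coeff n (s (m + 1))) p n = coeffAt (s (r.r p + 1)) p n :=
    coeffAt_mkRank _ p n
  refine ⟨_, fun p n hn => (hlim p n).trans (hs _ p n hn), fun m p n hp => ?_⟩
  rw [coeffAt_sub, hlim, sub_eq_zero]
  induction m, hp using Nat.le_induction with
  | base => rfl
  | succ m hm ih => rw [ih, eq_comm, ← sub_eq_zero, ← coeffAt_sub, hcauchy m p n hm]

theorem exists_lowDegree_of_bar_add_self {q : PowerSeries (IncAlg k W P)} (hq : q ∈ scriptI r)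
    (hqm : q ∈ rankFiltration r m) (hbar : bar r q + q ∈ rankFiltration r (m + 1)) :
    ∃ h ∈ lowDegree r, h ∈ rankFiltration r m ∧ q + (bar r h - h) ∈ rankFiltration r (m + 1) := by
  let h : PowerSeries (IncAlg k W P) := mkRank r fun m n => if 2 * n < m then coeff n q else 0
  have coeffAt_h (p : Intv P) (n : ℕ) :
      coeffAt h p n = if 2 * n < r.r p then coeffAt q p n else 0 :=
    (coeffAt_mkRank _ p n).trans ((apply_ite (comp p) _ _ _).trans (by rw [map_zero]; rfl))
  have hhm : h ∈ rankFiltration r m := fun p n hp => by rw [coeffAt_h, hqm p n hp, ite_self]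
  refine ⟨h, fun p n hn => by rw [coeffAt_h, if_neg hn.not_gt], hhm, ?_⟩
  rw [mem_rankFiltration_succ_iff (add_mem hqm (sub_mem (bar_mem_rankFiltration hhm) hhm))]
  intro p n hp
  have hsymm : n ≤ r.r p → coeffAt q p (r.r p - n) + coeffAt q p n = 0 := fun hn => by
    simpa [coeffAt_bar, hn] using hbar p n (by omega)
  rw [coeffAt_add, coeffAt_sub, coeffAt_bar, coeffAt_h, coeffAt_h]
  obtain hn | hn | hn := lt_trichotomy (2 * n) (r.r p)
  · rw [if_pos (by omega), if_neg (by omega), if_pos hn, zero_sub, add_neg_cancel]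
  · have hself := hsymm (by omega)
    rw [show r.r p - n = n by omega] at hself
    rw [show r.r p - n = n by omega, if_pos (by omega : n ≤ r.r p), if_neg hn.not_lt,
      self_eq_neg.1 (eq_neg_of_add_eq_zero_left hself), sub_self, add_zero]
  · by_cases hn' : n ≤ r.r p
    · rw [if_pos hn', if_pos (by omega), if_neg hn.not_gt, sub_zero, add_comm, hsymm hn']
    · rw [if_neg hn', if_neg hn.not_gt, hq p n (by omega), sub_zero, add_zero]

theorem mem_rankFiltration_succ_of_bar_sub_self (hf : f ∈ lowDegree r)
    (hfm : f ∈ rankFiltration r m) (hbar : bar r f - f ∈ rankFiltration r (m + 1)) :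
    f ∈ rankFiltration r (m + 1) := by
  rw [mem_rankFiltration_succ_iff hfm]
  intro p n hp
  by_cases hn : r.r p ≤ 2 * n
  · exact hf p n hn
  · have hpn := hbar p n (by omega)
    rw [coeffAt_sub, coeffAt_bar, if_pos (by omega), hf p _ (by omega), zero_sub] at hpn
    exact neg_eq_zero.1 hpn

end filtration

end PowerSeries

section KazhdanLusztigStanley

variable {k : Type u} {W : Type w} {P : Type v} [Field k] [Group W] [PartialOrder P]
  [PosetAction W P] [LocallyFiniteOrder P] {r : WeakRank W P}

theorem one_mem_scriptI : (1 : PowerSeries (IncAlg k W P)) ∈ scriptI r := by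
  rintro ⟨x, y, h⟩ n hn
  rw [coeffAt, PowerSeries.coeff_one, if_neg (by omega), map_zero]

theorem mem_scriptI_of_mem_scriptIHalf {f : PowerSeries (IncAlg k W P)} (hf : f ∈ scriptIHalf r) :
    f ∈ scriptI r := fun p n hn => by
  rw [← sub_add_cancel f 1, coeffAt_add, one_mem_scriptI p n hn,
    mem_scriptI_of_mem_lowDegree (mem_scriptIHalf_iff.1 hf) p n hn, add_zero]

theorem existsUnique_mem_scriptIHalf_fixedPoint
    {T : PowerSeries (IncAlg k W P) →+ PowerSeries (IncAlg k W P)}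
    (mem_scriptI : ∀ f, T f ∈ scriptI r) (involutive : ∀ f ∈ scriptI r, T (T f) = f)
    (triangular : ∀ m, ∀ f ∈ rankFiltration r m, T f - bar r f ∈ rankFiltration r (m + 1)) :
    ∃! f, f ∈ scriptIHalf r ∧ T f = f := by
  have anti : Antitone (rankFiltration (k := k) r) := fun a b hab f hf p n hp => hf p n (by omega)
  simp only [mem_scriptIHalf_iff]
  refine existsUnique_fixedPoint_of_filtration (F := rankFiltration r)
    (top_unique fun f _ p n hp => absurd hp (Nat.not_lt_zero _)) anti
    (fun f hf => ext_coeffAt fun p n => ?_)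
    (fun s => exists_limit_rankFiltration) (fun m f hf => ?_)
    (fun f hf => involutive f (mem_scriptI_of_mem_scriptIHalf (mem_scriptIHalf_iff.2 hf)))
    (fun m q hq hTq => ?_)
    (fun m h hH hm hT => ?_)
  · rw [hf (r.r p + 1) p n (Nat.lt_succ_self _), coeffAt_zero]
  · rw [← sub_add_cancel (T f) (bar r f)]
    exact add_mem (anti m.le_succ (triangular m f hf)) (bar_mem_rankFiltration hf)
  · have hqI : q ∈ scriptI r := by
      rw [← neg_neg q, ← hTq, ← map_neg]
      exact mem_scriptI _
    have hbar : bar r q + q ∈ rankFiltration r (m + 1) := by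
      have := triangular m q hq
      rwa [hTq, ← neg_mem_iff, neg_sub, sub_neg_eq_add] at this
    obtain ⟨h, hH, hm, hqh⟩ := exists_lowDegree_of_bar_add_self hqI hq hbar
    refine ⟨h, hH, ?_⟩
    convert add_mem hqh (triangular m h hm) using 1
    abel
  · refine mem_rankFiltration_succ_of_bar_sub_self hH hm ?_
    convert sub_mem hT (triangular m h hm) using 1
    abel

variable {κ f : PowerSeries (IncAlg k W P)} {m : ℕ}

theorem bar_mul_left_sub_bar_mem_rankFiltration (hκ : DiagOne κ) (hf : f ∈ rankFiltration r m) :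
    bar r (κ * f) - bar r f ∈ rankFiltration r (m + 1) := by
  rw [← map_sub, ← sub_one_mul, add_comm]
  exact bar_mem_rankFiltration
    (mul_mem_rankFiltration (sub_one_mem_rankFiltration_one hκ) hf)

theorem bar_mul_right_sub_bar_mem_rankFiltration (hκ : DiagOne κ) (hf : f ∈ rankFiltration r m) :
    bar r (f * κ) - bar r f ∈ rankFiltration r (m + 1) := by
  rw [← map_sub, ← mul_sub_one]
  exact bar_mem_rankFiltration
    (mul_mem_rankFiltration hf (sub_one_mem_rankFiltration_one hκ))

theorem isBar_iff_bar_eq {g : PowerSeries (IncAlg k W P)} (hf : f ∈ scriptI r)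
    (hg : g ∈ scriptI r) : IsBar r f g ↔ bar r g = f :=
  isBar_iff.trans ⟨fun h => by rw [← h, bar_bar hf], fun h => by rw [← h, bar_bar hg]⟩

namespace IsPKernel

theorem existsUnique_isBar_mul_left (hκ : IsPKernel r κ) :
    ∃! f, f ∈ scriptIHalf r ∧ IsBar r f (κ * f) := by
  obtain ⟨hκI, hdiag, κ', hbar, -, hκ'κ⟩ := hκ
  have isBar_iff_fixed (f : PowerSeries (IncAlg k W P)) :
      f ∈ scriptIHalf r ∧ IsBar r f (κ * f) ↔ f ∈ scriptIHalf r ∧ bar r (κ * f) = f :=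
    and_congr_right fun hf => isBar_iff_bar_eq (mem_scriptI_of_mem_scriptIHalf hf)
      (mul_mem_scriptI hκI (mem_scriptI_of_mem_scriptIHalf hf))
  refine (existsUnique_congr isBar_iff_fixed).2 (existsUnique_mem_scriptIHalf_fixedPoint
    (T := (bar r).comp (AddMonoidHom.mulLeft κ)) (fun _ => bar_mem_scriptI _) (fun f hf => ?_)
    fun m f hf => bar_mul_left_sub_bar_mem_rankFiltration hdiag hf)
  calc bar r (κ * bar r (κ * f))
    _ = bar r κ * bar r (bar r (κ * f)) := bar_mul hκI (bar_mem_scriptI _)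
    _ = κ' * (κ * f) := by rw [isBar_iff.1 hbar, bar_bar (mul_mem_scriptI hκI hf)]
    _ = f := by rw [← mul_assoc, hκ'κ, one_mul]

theorem existsUnique_isBar_mul_right (hκ : IsPKernel r κ) :
    ∃! g, g ∈ scriptIHalf r ∧ IsBar r g (g * κ) := by
  obtain ⟨hκI, hdiag, κ', hbar, hκκ', -⟩ := hκ
  have isBar_iff_fixed (g : PowerSeries (IncAlg k W P)) :
      g ∈ scriptIHalf r ∧ IsBar r g (g * κ) ↔ g ∈ scriptIHalf r ∧ bar r (g * κ) = g :=
    and_congr_right fun hg => isBar_iff_bar_eq (mem_scriptI_of_mem_scriptIHalf hg)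
      (mul_mem_scriptI (mem_scriptI_of_mem_scriptIHalf hg) hκI)
  refine (existsUnique_congr isBar_iff_fixed).2 (existsUnique_mem_scriptIHalf_fixedPoint
    (T := (bar r).comp (AddMonoidHom.mulRight κ)) (fun _ => bar_mem_scriptI _) (fun g hg => ?_)
    fun m g hg => bar_mul_right_sub_bar_mem_rankFiltration hdiag hg)
  calc bar r (bar r (g * κ) * κ)
    _ = bar r (bar r (g * κ)) * bar r κ := bar_mul (bar_mem_scriptI _) hκI
    _ = g * κ * κ' := by rw [isBar_iff.1 hbar, bar_bar (mul_mem_scriptI hg hκI)]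
    _ = g := by rw [mul_assoc, hκκ', mul_one]

end IsPKernel

end KazhdanLusztigStanley

end

theorem mainTheorem1_general {k : Type*} {W : Type*} {P : Type*} [Field k] [Group W]
    [PartialOrder P] [LocallyFiniteOrder P] [PosetAction W P] (r : WeakRank W P)
    (κ : PowerSeries (IncAlg k W P)) (hκ : IsPKernel r κ) :
    ∃! fg : PowerSeries (IncAlg k W P) × PowerSeries (IncAlg k W P),
      (fg.1 ∈ scriptIHalf r ∧ fg.2 ∈ scriptIHalf r) ∧
        IsBar r fg.1 (κ * fg.1) ∧ IsBar r fg.2 (fg.2 * κ) := by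
  obtain ⟨f, ⟨hf, hfκ⟩, funique⟩ := hκ.existsUnique_isBar_mul_left
  obtain ⟨g, ⟨hg, hgκ⟩, gunique⟩ := hκ.existsUnique_isBar_mul_right
  exact ⟨(f, g), ⟨⟨hf, hg⟩, hfκ, hgκ⟩, fun fg ⟨⟨hf', hg'⟩, hfκ', hgκ'⟩ =>
    Prod.ext (funique _ ⟨hf', hfκ'⟩) (gunique _ ⟨hg', hgκ'⟩)⟩

theorem mainTheorem1 {k : Type*} {W : Type*} {P : Type*} [Field k] [Group W] [Finite W]
    [PartialOrder P] [LocallyFiniteOrder P] [PosetAction W P] (r : WeakRank W P)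
    (κ : PowerSeries (IncAlg k W P)) (hκ : IsPKernel r κ) :
    ∃! fg : PowerSeries (IncAlg k W P) × PowerSeries (IncAlg k W P),
      (fg.1 ∈ scriptIHalf r ∧ fg.2 ∈ scriptIHalf r) ∧
        IsBar r fg.1 (κ * fg.1) ∧ IsBar r fg.2 (fg.2 * κ) :=
  mainTheorem1_general r κ hκ
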